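/- Let $(M,g)$ be a complete, simply connected smooth Riemannian manifold (of arbitrary finite dimension) without conjugate points, with Riemannian distance $d$ and unit tangent bundle $SM$. For $v\in SM$ let $\gamma_v:\mathbb R\to M$ be the geodesic with $\gamma_v'(0)=v$, let $b_v(x)=\lim_{t\to\infty}\bigl(d(x,\gamma_v(t))-t\bigr)$ be its Busemann function, and recall that $M$ is called asymptotically harmonic if there is a constant $h\ge 0$ such that, for every $v\in SM$, $b_v$ is of class $C^2$ and $\Delta b_v\equiv h$, where $\Delta=\operatorname{tr}\nabla d$; the horospheres (the level sets of the Busemann functions) are minimal if $h=0$. Suppose that $M$ is asymptotically harmonic with minimal horospheres, i.e. $\Delta b_v\equiv 0$ for all $v\in SM$, and that $M$ is a symmetric space, i.e. for every $p\in M$ there is an isometry $s_p$ of $M$ with $s_p(p)=p$ and $d(s_p)_p=-\mathrm{id}$. Then $M$ is flat, i.e. its Riemann curvature tensor vanishes identically. -/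

import Mathlib

open Filter Topology
open scoped Manifold ContDiff

set_option maxSynthPendingDepth 3

noncomputable section

namespace RiemGeom

/-! ### Levi-Civita calculus in coordinates

`G y` is the bilinear form of the metric at the point `y` of a coordinate domain in `E`. -/

section Coordinates

variable {E : Type*} [NormedAddCommGroup E] [NormedSpace ℝ E]

/-- `(u, w, z) ↦ ∂_z G(u, w)`. -/
def metricDerivRot (G : E → E →L[ℝ] E →L[ℝ] ℝ) (y : E) : E →L[ℝ] E →L[ℝ] E →L[ℝ] ℝ :=
  ((ContinuousLinearMap.flipₗᵢ ℝ E E ℝ).toContinuousLinearEquiv :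
      (E →L[ℝ] E →L[ℝ] ℝ) →L[ℝ] (E →L[ℝ] E →L[ℝ] ℝ)) ∘L (fderiv ℝ G y).flip

/-- Christoffel symbols of the first kind,
`(u, w, z) ↦ ½ (∂_u G(w, z) + ∂_w G(u, z) - ∂_z G(u, w))`. -/
def christoffelLower (G : E → E →L[ℝ] E →L[ℝ] ℝ) (y : E) : E →L[ℝ] E →L[ℝ] E →L[ℝ] ℝ :=
  (1 / 2 : ℝ) • (fderiv ℝ G y + (fderiv ℝ G y).flip - metricDerivRot G y)

theorem christoffelLower_apply (G : E → E →L[ℝ] E →L[ℝ] ℝ) (y u w z : E) :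
    christoffelLower G y u w z =
      (1 / 2 : ℝ) * (fderiv ℝ G y u w z + fderiv ℝ G y w u z - fderiv ℝ G y z u w) := rfl

/-- Christoffel symbols `Γ(u, w)` of the Levi-Civita connection, obtained from the symbols of the
first kind by raising an index with `G⁻¹`. -/
def christoffel (G : E → E →L[ℝ] E →L[ℝ] ℝ) (y : E) : E →L[ℝ] E →L[ℝ] E :=
  (ContinuousLinearMap.compL ℝ E (E →L[ℝ] ℝ) E (G y).inverse) ∘L christoffelLower G y

/-- The curvature tensor in coordinates,
`R(u, v)w = (∂_u Γ)(v, w) - (∂_v Γ)(u, w) + Γ(u, Γ(v, w)) - Γ(v, Γ(u, w))`, that is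
`R(X, Y)Z = ∇_X ∇_Y Z - ∇_Y ∇_X Z - ∇_[X, Y] Z`. -/
def coordCurvature (G : E → E →L[ℝ] E →L[ℝ] ℝ) (y u v w : E) : E :=
  fderiv ℝ (christoffel G) y u v w - fderiv ℝ (christoffel G) y v u w +
    christoffel G y u (christoffel G y v w) - christoffel G y v (christoffel G y u w)

/-- The Hessian `∇df` in coordinates, `(u, w) ↦ ∂_u ∂_w f - df(Γ(u, w))`. -/
def coordHessian (G : E → E →L[ℝ] E →L[ℝ] ℝ) (f : E → ℝ) (y : E) : E →L[ℝ] E →L[ℝ] ℝ :=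
  fderiv ℝ (fderiv ℝ f) y - (ContinuousLinearMap.compL ℝ E E ℝ (fderiv ℝ f y)) ∘L christoffel G y

/-- The Laplace-Beltrami operator in coordinates: the trace of the Hessian with respect to `G`. -/
def coordLaplacian (G : E → E →L[ℝ] E →L[ℝ] ℝ) (f : E → ℝ) (y : E) : ℝ :=
  LinearMap.trace ℝ E (((G y).inverse ∘L coordHessian G f y : E →L[ℝ] E) : E →ₗ[ℝ] E)

end Coordinates

/-! ### Riemannian manifolds

`M` is a smooth manifold without boundary modelled on the finite-dimensional space `E`.  The chart
with centre `c : M` is `extChartAt 𝓘(ℝ, E) c`.  The instance `RiemannianBundle` is the Riemannian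
metric. -/

open Bundle

section Charts

variable {E : Type*} [NormedAddCommGroup E] [NormedSpace ℝ E]
  {M : Type*} [TopologicalSpace M] [ChartedSpace E M]

/-- The coordinates of a tangent vector at `x` in the chart centred at `c`. -/
def coord (c x : M) : TangentSpace 𝓘(ℝ, E) x →L[ℝ] E :=
  mfderiv 𝓘(ℝ, E) 𝓘(ℝ, E) (extChartAt 𝓘(ℝ, E) c) x

/-- The velocity `γ'(t)` of a curve. -/
def velocity (E : Type*) [NormedAddCommGroup E] [NormedSpace ℝ E] {M : Type*} [TopologicalSpace M]
    [ChartedSpace E M] (γ : ℝ → M) (t : ℝ) : TangentSpace 𝓘(ℝ, E) (γ t) :=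
  mfderiv 𝓘(ℝ, ℝ) 𝓘(ℝ, E) γ t (1 : ℝ)

variable [RiemannianBundle (fun x : M ↦ TangentSpace 𝓘(ℝ, E) x)]

/-- The metric coefficients in the chart centred at `c`: the Riemannian metric pulled back by the
inverse of the chart. -/
def chartMetric (c : M) (y : E) : E →L[ℝ] E →L[ℝ] ℝ :=
  (innerSL ℝ (E := TangentSpace 𝓘(ℝ, E) ((extChartAt 𝓘(ℝ, E) c).symm y))).bilinearComp
    (mfderiv 𝓘(ℝ, E) 𝓘(ℝ, E) (extChartAt 𝓘(ℝ, E) c).symm y)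
    (mfderiv 𝓘(ℝ, E) 𝓘(ℝ, E) (extChartAt 𝓘(ℝ, E) c).symm y)

/-- The Riemann curvature tensor `R(u, v)w` at `p`. -/
def curvature (p : M) (u v w : TangentSpace 𝓘(ℝ, E) p) : TangentSpace 𝓘(ℝ, E) p :=
  (coord p p).inverse (coordCurvature (chartMetric p) (extChartAt 𝓘(ℝ, E) p p)
    (coord p p u) (coord p p v) (coord p p w))

/-- The Laplace-Beltrami operator `Δ = tr ∇d`. -/
def laplacian (E : Type*) [NormedAddCommGroup E] [NormedSpace ℝ E] {M : Type*} [TopologicalSpace M]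
    [ChartedSpace E M] [RiemannianBundle (fun x : M ↦ TangentSpace 𝓘(ℝ, E) x)]
    (f : M → ℝ) (p : M) : ℝ :=
  coordLaplacian (chartMetric p) (f ∘ (extChartAt 𝓘(ℝ, E) p).symm) (extChartAt 𝓘(ℝ, E) p p)

/-- The covariant derivative `V'(t)` of a vector field `V` along the curve `γ`; in coordinates
`dV/dt + Γ(γ', V)`. -/
def covDerivAlong (γ : ℝ → M) (V : ∀ t, TangentSpace 𝓘(ℝ, E) (γ t)) (t : ℝ) :
    TangentSpace 𝓘(ℝ, E) (γ t) :=
  (coord (γ t) (γ t)).inverse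
    (deriv (fun s ↦ coord (γ t) (γ s) (V s)) t +
      christoffel (chartMetric (γ t)) (extChartAt 𝓘(ℝ, E) (γ t) (γ t))
        (coord (γ t) (γ t) (velocity E γ t)) (coord (γ t) (γ t) (V t)))

end Charts

/-! ### Geodesics, Jacobi fields, Busemann functions -/

section Manifold

variable (E : Type*) [NormedAddCommGroup E] [NormedSpace ℝ E]
  {M : Type*} [MetricSpace M] [ChartedSpace E M] [IsManifold 𝓘(ℝ, E) ∞ M]
  [RiemannianBundle (fun x : M ↦ TangentSpace 𝓘(ℝ, E) x)]

/-- Geodesics defined on the whole real line. -/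
structure IsGeodesic (γ : ℝ → M) : Prop where
  contMDiff : ContMDiff 𝓘(ℝ, ℝ) 𝓘(ℝ, E) ∞ γ
  covDeriv_velocity : ∀ t, covDerivAlong γ (velocity E γ) t = 0

/-- Geodesics `γ_v` with `v` in the unit tangent bundle. -/
structure IsUnitSpeedGeodesic (γ : ℝ → M) : Prop extends IsGeodesic E γ where
  norm_velocity : ∀ t, ‖velocity E γ t‖ = 1

variable {E} in
/-- Jacobi fields along `γ`: smooth vector fields along `γ` with `J'' + R(J, γ')γ' = 0`. -/
structure IsJacobiField (γ : ℝ → M) (J : ∀ t, TangentSpace 𝓘(ℝ, E) (γ t)) : Prop where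
  contMDiff : ContMDiff 𝓘(ℝ, ℝ) 𝓘(ℝ, E).tangent ∞
    (fun t ↦ (⟨γ t, J t⟩ : TangentBundle 𝓘(ℝ, E) M))
  jacobi : ∀ t, covDerivAlong γ (covDerivAlong γ J) t +
    curvature (γ t) (J t) (velocity E γ t) (velocity E γ t) = 0

variable (M) in
/-- No conjugate points: a Jacobi field along a geodesic that vanishes at two different parameters
vanishes identically. -/
def NoConjugatePoints : Prop :=
  ∀ (γ : ℝ → M) (J : ∀ t, TangentSpace 𝓘(ℝ, E) (γ t)), IsGeodesic E γ → IsJacobiField γ J →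
    ∀ a b : ℝ, a ≠ b → J a = 0 → J b = 0 → ∀ t, J t = 0

/-- `b` is the Busemann function of `γ`: `b(x) = lim_{t → ∞} (d(x, γ(t)) - t)` for all `x`. -/
def IsBusemannFunction {M : Type*} [MetricSpace M] (γ : ℝ → M) (b : M → ℝ) : Prop :=
  ∀ x, Tendsto (fun t : ℝ ↦ dist x (γ t) - t) atTop (𝓝 (b x))

variable (M) in
/-- `M` is asymptotically harmonic and its horospheres have mean curvature `h`: `M` is complete,
simply connected, without conjugate points, and every Busemann function `b_v` satisfies
`Δ b_v ≡ h`. The horospheres are minimal if `h = 0`. -/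
structure IsAsymptoticallyHarmonic (h : ℝ) : Prop where
  complete : CompleteSpace M
  simplyConnected : SimplyConnectedSpace M
  noConjugatePoints : NoConjugatePoints E M
  nonneg : 0 ≤ h
  laplacian_busemann : ∀ γ : ℝ → M, IsUnitSpeedGeodesic E γ →
    ∃ b : M → ℝ, IsBusemannFunction γ b ∧ ContMDiff 𝓘(ℝ, E) 𝓘(ℝ, ℝ) 2 b ∧
      ∀ x, laplacian E b x = h

variable (M) in
/-- Riemannian symmetric spaces: every point `p` is fixed by an isometry of `M` whose differential
at `p` is `-id`. -/
def IsSymmetricSpace : Prop :=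
  ∀ p : M, ∃ s : M ≃ₘ^∞⟮𝓘(ℝ, E), 𝓘(ℝ, E)⟯ M,
    (∀ (x : M) (u w : TangentSpace 𝓘(ℝ, E) x),
      inner ℝ (mfderiv 𝓘(ℝ, E) 𝓘(ℝ, E) s x u) (mfderiv 𝓘(ℝ, E) 𝓘(ℝ, E) s x w) = inner ℝ u w) ∧
    ∀ u : TangentSpace 𝓘(ℝ, E) p,
      tangentMap 𝓘(ℝ, E) 𝓘(ℝ, E) s ⟨p, u⟩ = (⟨p, -u⟩ : TangentBundle 𝓘(ℝ, E) M)

variable (M) in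
/-- `M` is flat: its curvature tensor vanishes identically. -/
def IsFlat : Prop :=
  ∀ (p : M) (u v w : TangentSpace 𝓘(ℝ, E) p), curvature p u v w = 0

end Manifold

end RiemGeom

end

open Bundle

set_option linter.unusedSectionVars false

/-! Let `T` be the product of the symmetries at two nearby points of a geodesic `γ`; it translates
`γ` into itself. This extends every geodesic germ to all of `ℝ`. It also makes `γ` a minimizing
line: a shortcut between two points of `γ` would be repeated in every period, and `d(x, γ t) - t`
would tend to `-∞` for a point `x` of `γ`, whereas the Busemann function requires a finite limit
(`IsBusemannFunction.dist_eq`).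

Let `b` be the Busemann function of the line `γ`, let `p = γ t`, and let `s` be the symmetry at `p`.
Then `s ∘ γ` is `γ` run backwards, and its Busemann function `b'` satisfies `b' ∘ s = b`. By the
triangle inequality `b + b'` attains its minimum at `p`, so `Hess b + Hess b' ≥ 0` there. Since `ds
= -id` at `p` and the Hessian is bilinear, the two Hessians agree at `p`; hence `Hess b ≥ 0`. Its
trace is `Δb = 0`, so `Hess b = 0` along all of `γ` (`coordHessian_busemann_eq_zero`).

The field `X = -grad b` has unit length (`IsBusemannFunction.eikonal`), so `∇_X X = 0`; it extends
`γ'`, and `∇X = 0` along `γ`. The Riccati equation would now give `R(w, γ')γ' = 0`. But `b` is only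
of class `C²`, so `∇X` cannot be differentiated; `curvature_eq_zero_of_parallel_along` replaces the
Riccati equation by two evaluations of a mixed derivative of `X` along a variation of `γ`. As every
unit vector is the velocity of such a line, `R(w, v)v = 0` for all `w`, `v`, and polarization with
the first Bianchi identity gives `R = 0`. -/

namespace RiemGeom

/-! ### Metrics in coordinates: Christoffel symbols and invariance under local isometries. -/

section CoordinateLemmas

variable {E : Type*} [NormedAddCommGroup E] [NormedSpace ℝ E]

/-- `G` is a smooth Riemannian metric on the open set `U` of the coordinate space. -/
structure IsMetricOn (G : E → E →L[ℝ] E →L[ℝ] ℝ) (U : Set E) : Prop where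
  isOpen : IsOpen U
  contDiffOn : ContDiffOn ℝ ∞ G U
  symm : ∀ y ∈ U, ∀ u w, G y u w = G y w u
  pos : ∀ y ∈ U, ∀ u, u ≠ 0 → 0 < G y u u

theorem fderiv_bilin_apply {G : E → E →L[ℝ] E →L[ℝ] ℝ} {y : E} (hG : DifferentiableAt ℝ G y)
    (u w z : E) : fderiv ℝ (fun x ↦ G x u w) y z = fderiv ℝ G y z u w := by
  have := ((hG.hasFDerivAt.clm_apply (hasFDerivAt_const u y)).clm_apply (hasFDerivAt_const w y))
  rw [this.fderiv]; simp

namespace IsMetricOn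

variable {G : E → E →L[ℝ] E →L[ℝ] ℝ} {U : Set E} {y : E}

theorem contDiffAt (h : IsMetricOn G U) (hy : y ∈ U) : ContDiffAt ℝ ∞ G y :=
  h.contDiffOn.contDiffAt (h.isOpen.mem_nhds hy)

theorem differentiableAt (h : IsMetricOn G U) (hy : y ∈ U) : DifferentiableAt ℝ G y :=
  (h.contDiffAt hy).differentiableAt (by simp)

theorem eventually_mem (h : IsMetricOn G U) (hy : y ∈ U) : ∀ᶠ x in 𝓝 y, x ∈ U :=
  h.isOpen.mem_nhds hy

theorem fderiv_symm (h : IsMetricOn G U) (hy : y ∈ U) (z u w : E) :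
    fderiv ℝ G y z u w = fderiv ℝ G y z w u := by
  rw [← fderiv_bilin_apply (h.differentiableAt hy), ← fderiv_bilin_apply (h.differentiableAt hy)]
  congr 1
  apply Filter.EventuallyEq.fderiv_eq
  filter_upwards [h.eventually_mem hy] with x hx using h.symm x hx u w

theorem eq_of_forall (h : IsMetricOn G U) (hy : y ∈ U) {a b : E}
    (hab : ∀ z, G y a z = G y b z) : a = b := by
  by_contra hne
  have := h.pos y hy (a - b) (sub_ne_zero.2 hne)
  simp [hab] at this

variable [FiniteDimensional ℝ E]

/-- `ContinuousLinearMap.inverse` is `0` on maps that are not invertible. This lemma is what makes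
`(G y).inverse` in the definitions raise an index. -/
theorem isInvertible (h : IsMetricOn G U) (hy : y ∈ U) : (G y).IsInvertible := by
  have hinj : Function.Injective (G y : E →ₗ[ℝ] (E →L[ℝ] ℝ)) := fun a b hab ↦
    h.eq_of_forall hy fun z ↦ by
      have : G y a = G y b := hab
      rw [this]
  have hdim : Module.finrank ℝ E = Module.finrank ℝ (E →L[ℝ] ℝ) := by
    rw [← (LinearMap.toContinuousLinearMap (𝕜 := ℝ) (E := E) (F' := ℝ)).finrank_eq]
    exact (Subspace.dual_finrank_eq).symm
  refine ⟨(LinearEquiv.ofInjectiveOfFinrankEq _ hinj hdim).toContinuousLinearEquiv, ?_⟩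
  ext u w
  rfl

theorem apply_inverse (h : IsMetricOn G U) (hy : y ∈ U) (φ : E →L[ℝ] ℝ) (z : E) :
    G y ((G y).inverse φ) z = φ z := by
  rw [(h.isInvertible hy).self_apply_inverse]

theorem contDiffOn_inverse (h : IsMetricOn G U) :
    ContDiffOn ℝ ∞ (fun x ↦ (G x).inverse) U := by
  have := FiniteDimensional.complete ℝ E
  intro x hx
  obtain ⟨e, he⟩ := h.isInvertible hx
  have h1 : ContDiffAt ℝ ∞ ContinuousLinearMap.inverse (G x) := he ▸ contDiffAt_map_inverse e
  exact (h1.comp x (h.contDiffAt hx)).contDiffWithinAt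

/-- Koszul's formula. Identities for `christoffel` are checked by pairing with `G`, so that the
inverse metric disappears. -/
theorem apply_christoffel (h : IsMetricOn G U) (hy : y ∈ U) (u w z : E) :
    G y (christoffel G y u w) z =
      (1 / 2 : ℝ) * (fderiv ℝ G y u w z + fderiv ℝ G y w u z - fderiv ℝ G y z u w) := by
  rw [← christoffelLower_apply]
  exact h.apply_inverse hy _ _

theorem christoffel_symm (h : IsMetricOn G U) (hy : y ∈ U) (u w : E) :
    christoffel G y u w = christoffel G y w u := by
  refine h.eq_of_forall hy fun z ↦ ?_
  rw [h.apply_christoffel hy, h.apply_christoffel hy, h.fderiv_symm hy z u w]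
  ring

theorem contDiffOn_christoffel (h : IsMetricOn G U) : ContDiffOn ℝ ∞ (christoffel G) U := by
  have hd : ContDiffOn ℝ ∞ (fderiv ℝ G) U := h.contDiffOn.fderiv_of_isOpen h.isOpen (by simp)
  have hf : ContDiffOn ℝ ∞ (fun x ↦ (fderiv ℝ G x).flip) U :=
    (ContinuousLinearMap.flipₗᵢ ℝ E E (E →L[ℝ] ℝ)).contDiff.comp_contDiffOn hd
  have hl : ContDiffOn ℝ ∞ (christoffelLower G) U := by
    have hr : ContDiffOn ℝ ∞ (metricDerivRot G) U := contDiffOn_const.clm_comp hf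
    exact ((hd.add hf).sub hr).const_smul (1 / 2 : ℝ)
  exact ((ContinuousLinearMap.compL ℝ E (E →L[ℝ] ℝ) E).contDiff.comp_contDiffOn
    h.contDiffOn_inverse).clm_comp hl

theorem contDiffAt_christoffel (h : IsMetricOn G U) (hy : y ∈ U) :
    ContDiffAt ℝ ∞ (christoffel G) y :=
  h.contDiffOn_christoffel.contDiffAt (h.isOpen.mem_nhds hy)

/-- The Christoffel symbols of two metrics related by a local isometry `F`. -/
theorem fderiv_christoffel {G₂ : E → E →L[ℝ] E →L[ℝ] ℝ} {U₂ : Set E} {F : E → E}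
    (h : IsMetricOn G U) (hy : y ∈ U) (h₂ : IsMetricOn G₂ U₂) (hFy : F y ∈ U₂)
    (hF : ContDiffAt ℝ 2 F y)
    (hiso : ∀ᶠ x in 𝓝 y, ∀ u w, G x u w = G₂ (F x) (fderiv ℝ F x u) (fderiv ℝ F x w))
    (hsurj : Function.Surjective (fderiv ℝ F y)) (u w : E) :
    fderiv ℝ F y (christoffel G y u w) = fderiv ℝ (fderiv ℝ F) y u w +
      christoffel G₂ (F y) (fderiv ℝ F y u) (fderiv ℝ F y w) := by
  have hF1 : HasFDerivAt F (fderiv ℝ F y) y := (hF.differentiableAt (by simp)).hasFDerivAt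
  have hF2 : HasFDerivAt (fderiv ℝ F) (fderiv ℝ (fderiv ℝ F) y) y :=
    ((hF.fderiv_right (m := 1) (by norm_num)).differentiableAt (by simp)).hasFDerivAt
  have hG₂ : HasFDerivAt (fun x ↦ G₂ (F x)) ((fderiv ℝ G₂ (F y)).comp (fderiv ℝ F y)) y :=
    (h₂.differentiableAt hFy).hasFDerivAt.comp y hF1
  have key : ∀ z u w, fderiv ℝ G y z u w =
      fderiv ℝ G₂ (F y) (fderiv ℝ F y z) (fderiv ℝ F y u) (fderiv ℝ F y w)
      + G₂ (F y) (fderiv ℝ (fderiv ℝ F) y z u) (fderiv ℝ F y w)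
      + G₂ (F y) (fderiv ℝ F y u) (fderiv ℝ (fderiv ℝ F) y z w) := by
    intro z u w
    rw [← fderiv_bilin_apply (h.differentiableAt hy)]
    have h1 := (hG₂.clm_apply (hF2.clm_apply (hasFDerivAt_const u y))).clm_apply
      (hF2.clm_apply (hasFDerivAt_const w y))
    have h2 : (fun x ↦ G x u w) =ᶠ[𝓝 y]
        fun x ↦ G₂ (F x) (fderiv ℝ F x u) (fderiv ℝ F x w) := by
      filter_upwards [hiso] with x hx using hx u w
    rw [h2.fderiv_eq, h1.fderiv]
    simp
    ring
  have hsym : ∀ u w, fderiv ℝ (fderiv ℝ F) y u w = fderiv ℝ (fderiv ℝ F) y w u :=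
    fun u w ↦ hF.isSymmSndFDerivAt (by simp) u w
  -- Test vectors may be taken in the image of `fderiv ℝ F y`. In the Koszul combination of `key`
  -- the second derivatives of `F` cancel, by their symmetry, except for the one in the directions
  -- `u`, `w`.
  refine h₂.eq_of_forall hFy fun z' ↦ ?_
  obtain ⟨z, rfl⟩ := hsurj z'
  rw [← hiso.self_of_nhds, h.apply_christoffel hy, map_add, add_apply,
    h₂.apply_christoffel hFy, key, key, key, hsym w u, hsym z w, hsym z u,
    h₂.symm _ hFy (fderiv ℝ F y w) , h₂.symm _ hFy (fderiv ℝ (fderiv ℝ F) y u z)]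
  ring

/-- Invariance of the Hessian under local isometries. -/
theorem coordHessian_comp {G₂ : E → E →L[ℝ] E →L[ℝ] ℝ} {U₂ : Set E} {F : E → E}
    (h : IsMetricOn G U) (hy : y ∈ U) (h₂ : IsMetricOn G₂ U₂) (hFy : F y ∈ U₂)
    (hF : ContDiffAt ℝ 2 F y)
    (hiso : ∀ᶠ x in 𝓝 y, ∀ u w, G x u w = G₂ (F x) (fderiv ℝ F x u) (fderiv ℝ F x w))
    (hsurj : Function.Surjective (fderiv ℝ F y)) {f : E → ℝ} (hf : ContDiffAt ℝ 2 f (F y))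
    (u w : E) :
    coordHessian G (f ∘ F) y u w =
      coordHessian G₂ f (F y) (fderiv ℝ F y u) (fderiv ℝ F y w) := by
  have hF1 : HasFDerivAt F (fderiv ℝ F y) y := (hF.differentiableAt (by simp)).hasFDerivAt
  have hF2 : HasFDerivAt (fderiv ℝ F) (fderiv ℝ (fderiv ℝ F) y) y :=
    ((hF.fderiv_right (m := 1) (by norm_num)).differentiableAt (by simp)).hasFDerivAt
  have hf2 : HasFDerivAt (fderiv ℝ f) (fderiv ℝ (fderiv ℝ f) (F y)) (F y) :=
    ((hf.fderiv_right (m := 1) (by norm_num)).differentiableAt (by simp)).hasFDerivAt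
  have hcomp : fderiv ℝ (f ∘ F) =ᶠ[𝓝 y] fun x ↦ (fderiv ℝ f (F x)).comp (fderiv ℝ F x) := by
    filter_upwards [hF.eventually (by simp), hF.continuousAt.eventually (hf.eventually (by simp))]
      with x hx1 hx2
    exact fderiv_comp x (hx2.differentiableAt (by simp)) (hx1.differentiableAt (by simp))
  have h1 : fderiv ℝ (fderiv ℝ (f ∘ F)) y u w =
      fderiv ℝ (fderiv ℝ f) (F y) (fderiv ℝ F y u) (fderiv ℝ F y w) +
        fderiv ℝ f (F y) (fderiv ℝ (fderiv ℝ F) y u w) := by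
    have h0 : HasFDerivAt (fun x ↦ fderiv ℝ f (F x)) _ y := hf2.comp y hF1
    rw [hcomp.fderiv_eq, (h0.clm_comp hF2).fderiv]
    simp [add_comm]
  -- The inhomogeneous term here cancels the second-derivative term of the chain rule in `h1`.
  have h2 := h.fderiv_christoffel hy h₂ hFy hF hiso hsurj u w
  simp only [coordHessian, sub_apply, ContinuousLinearMap.comp_apply,
    ContinuousLinearMap.compL_apply, h1, hcomp.self_of_nhds, h2, map_add]
  ring

end IsMetricOn

/-- The covariant acceleration `y'' + Γ(y', y')` of a curve in coordinates. -/
noncomputable def coordAccel (G : E → E →L[ℝ] E →L[ℝ] ℝ) (y : ℝ → E) (t : ℝ) : E :=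
  deriv (deriv y) t + christoffel G (y t) (deriv y t) (deriv y t)

/-- Invariance of the covariant acceleration under local isometries. -/
theorem IsMetricOn.coordAccel_comp [FiniteDimensional ℝ E] {G G₂ : E → E →L[ℝ] E →L[ℝ] ℝ}
    {U U₂ : Set E} {F : E → E} {y : ℝ → E} {t : ℝ}
    (h : IsMetricOn G U) (hy : y t ∈ U) (h₂ : IsMetricOn G₂ U₂) (hFy : F (y t) ∈ U₂)
    (hF : ContDiffAt ℝ 2 F (y t))
    (hiso : ∀ᶠ x in 𝓝 (y t), ∀ u w, G x u w = G₂ (F x) (fderiv ℝ F x u) (fderiv ℝ F x w))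
    (hsurj : Function.Surjective (fderiv ℝ F (y t))) (hyt : ContDiffAt ℝ 2 y t) :
    coordAccel G₂ (F ∘ y) t = fderiv ℝ F (y t) (coordAccel G y t) := by
  have hF2 : HasFDerivAt (fderiv ℝ F) (fderiv ℝ (fderiv ℝ F) (y t)) (y t) :=
    ((hF.fderiv_right (m := 1) (by norm_num)).differentiableAt (by simp)).hasFDerivAt
  have hy1 : HasDerivAt y (deriv y t) t := (hyt.differentiableAt (by simp)).hasDerivAt
  have hy2 : HasDerivAt (deriv y) (deriv (deriv y) t) t := by
    have : ContDiffAt ℝ 1 (fun s ↦ fderiv ℝ y s 1) t :=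
      (hyt.fderiv_right (m := 1) (by norm_num)).clm_apply contDiffAt_const
    exact (this.differentiableAt (by simp)).hasDerivAt
  have hcomp : deriv (F ∘ y) =ᶠ[𝓝 t] fun s ↦ fderiv ℝ F (y s) (deriv y s) := by
    filter_upwards [hyt.eventually (by simp), hyt.continuousAt.eventually (hF.eventually (by simp))]
      with s hs1 hs2
    exact fderiv_comp_deriv s (hs2.differentiableAt (by simp)) (hs1.differentiableAt (by simp))
  have h0 : HasDerivAt (fun s ↦ fderiv ℝ F (y s)) _ t := hF2.comp_hasDerivAt t hy1
  have h1 := h0.clm_apply hy2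
  rw [coordAccel, coordAccel, hcomp.deriv_eq, hcomp.self_of_nhds, map_add,
    h.fderiv_christoffel hy h₂ hFy hF hiso hsurj, h1.deriv]
  simp only [Function.comp_apply]
  abel

end CoordinateLemmas

/-! ### Mixed derivatives at low regularity and the vanishing of curvature. -/

section LocalAnalysis

variable {E : Type*} [NormedAddCommGroup E] [NormedSpace ℝ E]

open Asymptotics in
/-- Interchange of partial derivatives under a weak hypothesis: `g = ∂f/∂t` exists near the origin,
`k = ∂f/∂ε` exists on the axis `ε = 0`, and `g(t, ε) - g(t, 0) = ε c + o(ε)` as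
`(t, ε) → (0, 0)`. -/
theorem hasDerivWithinAt_of_mixed_isLittleO {f g : ℝ × ℝ → E} {k : ℝ → E} {c : E}
    (hf : ∀ᶠ p in 𝓝 (0 : ℝ × ℝ), HasDerivAt (fun t ↦ f (t, p.2)) (g p) p.1)
    (hk : ∀ᶠ t in 𝓝 (0 : ℝ), HasDerivAt (fun ε ↦ f (t, ε)) (k t) 0)
    (hg : (fun p : ℝ × ℝ ↦ g p - g (p.1, 0) - p.2 • c) =o[𝓝 0] fun p ↦ p.2) :
    HasDerivWithinAt k c (Set.Ici 0) 0 := by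
  rw [hasDerivWithinAt_iff_isLittleO, isLittleO_iff]
  intro η hη
  obtain ⟨δ, hδ, hball⟩ := Metric.eventually_nhds_iff.1 (hf.and (isLittleO_iff.1 hg hη))
  obtain ⟨δ', hδ', hk'⟩ := Metric.eventually_nhds_iff.1 hk
  have hlt : ∀ᶠ t in 𝓝[Set.Ici 0] (0 : ℝ), t < min δ δ' :=
    nhdsWithin_le_nhds (Iio_mem_nhds (lt_min hδ hδ'))
  filter_upwards [hlt, self_mem_nhdsWithin] with t ht ht0
  have ht0 : 0 ≤ t := ht0
  have hmem : ∀ s ∈ Set.Icc 0 t, ∀ ε, |ε| < δ → dist ((s, ε) : ℝ × ℝ) 0 < δ := by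
    intro s hs ε hε
    rw [Prod.dist_eq, max_lt_iff]
    refine ⟨?_, by simpa using hε⟩
    simpa [abs_of_nonneg hs.1] using hs.2.trans_lt (ht.trans_le (min_le_left _ _))
  -- Mean value inequality in the first variable for `f (s, ε) - f (s, 0) - (s * ε) • c`, divided by
  -- `ε`. The bound `η * t` does not depend on `ε`, so it survives the limit `ε → 0+`.
  have hmv : ∀ ε, 0 < ε → ε < δ →
      ‖ε⁻¹ • (f (t, ε) - f (t, 0)) - ε⁻¹ • (f (0, ε) - f (0, 0)) - t • c‖ ≤ η * t := by
    intro ε hε hεδ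
    have h1 := norm_image_sub_le_of_norm_deriv_le_segment' (a := 0) (b := t) (C := η * ε)
      (f := fun s ↦ f (s, ε) - f (s, 0) - (s * ε) • c)
      (f' := fun s ↦ g (s, ε) - g (s, 0) - ε • c) ?_ ?_ t ⟨ht0, le_rfl⟩
    · have h2 : ε⁻¹ • (f (t, ε) - f (t, 0)) - ε⁻¹ • (f (0, ε) - f (0, 0)) - t • c =
          ε⁻¹ • ((f (t, ε) - f (t, 0) - (t * ε) • c) - (f (0, ε) - f (0, 0) - ((0 : ℝ) * ε) • c)) := by
        simp only [smul_sub, smul_smul]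
        have : ε⁻¹ * (t * ε) = t := by field_simp
        rw [this]; simp; abel
      rw [h2, norm_smul, norm_inv, Real.norm_of_nonneg hε.le, inv_mul_le_iff₀ hε]
      refine h1.trans (le_of_eq ?_)
      ring
    · intro s hs
      have e1 := (hball (hmem s hs ε (by rwa [abs_of_pos hε]))).1
      have e2 := (hball (hmem s hs 0 (by simpa using hδ))).1
      have e3 : HasDerivAt (fun s : ℝ ↦ (s * ε) • c) (ε • c) s := by
        simpa using ((hasDerivAt_id s).mul_const ε).smul_const c
      exact ((e1.sub e2).sub e3).hasDerivWithinAt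
    · intro s hs
      have := (hball (hmem s ⟨hs.1, hs.2.le⟩ ε (by rwa [abs_of_pos hε]))).2
      simpa [abs_of_pos hε] using this
  have hlim : ∀ s ∈ Set.Icc 0 t,
      Tendsto (fun ε : ℝ ↦ ε⁻¹ • (f (s, ε) - f (s, 0))) (𝓝[>] 0) (𝓝 (k s)) := by
    intro s hs
    have hs' : HasDerivAt (fun ε ↦ f (s, ε)) (k s) 0 := by
      apply hk'
      simpa [abs_of_nonneg hs.1] using hs.2.trans_lt (ht.trans_le (min_le_right _ _))
    have := hs'.tendsto_slope_zero_right
    simpa using this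
  have hfin : Tendsto (fun ε : ℝ ↦
      ‖ε⁻¹ • (f (t, ε) - f (t, 0)) - ε⁻¹ • (f (0, ε) - f (0, 0)) - t • c‖) (𝓝[>] 0)
      (𝓝 ‖k t - k 0 - t • c‖) :=
    (((hlim t ⟨ht0, le_rfl⟩).sub (hlim 0 ⟨le_rfl, ht0⟩)).sub_const _).norm
  have hle : ‖k t - k 0 - t • c‖ ≤ η * t := by
    refine le_of_tendsto hfin ?_
    filter_upwards [Ioo_mem_nhdsGT hδ] with ε hε using hmv ε hε.1 hε.2
  simpa [abs_of_nonneg ht0] using hle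

open Asymptotics in
/-- If the vector field `X` is of class `C¹`, satisfies `∇_X X = 0`, and `∇X = 0` along an integral
curve of `X`, then `R(w, X)X = 0` along this curve. -/
theorem curvature_eq_zero_of_parallel_along {Γ : E → E →L[ℝ] E →L[ℝ] E} {X : E → E} {γ : ℝ → E}
    (hΓ : ContDiffAt ℝ 1 Γ (γ 0)) (hsymm : ∀ u w, Γ (γ 0) u w = Γ (γ 0) w u)
    (hX : ContDiffAt ℝ 1 X (γ 0))
    (hXX : ∀ᶠ y in 𝓝 (γ 0), fderiv ℝ X y (X y) + Γ y (X y) (X y) = 0)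
    (hγ : ∀ᶠ t in 𝓝 0, HasDerivAt γ (X (γ t)) t)
    (hpar : ∀ᶠ t in 𝓝 0, ∀ u, fderiv ℝ X (γ t) u + Γ (γ t) u (X (γ t)) = 0) (w : E) :
    fderiv ℝ Γ (γ 0) w (X (γ 0)) (X (γ 0)) - fderiv ℝ Γ (γ 0) (X (γ 0)) w (X (γ 0)) +
      Γ (γ 0) w (Γ (γ 0) (X (γ 0)) (X (γ 0))) - Γ (γ 0) (X (γ 0)) (Γ (γ 0) w (X (γ 0))) = 0 := by
  set y₀ := γ 0 with hy₀
  set v := X y₀ with hv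
  set w₁ := fderiv ℝ X y₀ w with hw₁
  -- The variation is `q (t, ε) = γ t + ε • P t`. The slope `w₁ = DX(w)` makes `∂q/∂t = X (γ t) + ε
  -- • w₁` agree with `X (q (t, ε))` up to `o(ε)`.
  set P : ℝ → E := fun t ↦ w + t • w₁ with hP
  have hγ0 : HasDerivAt γ v 0 := hγ.self_of_nhds
  have hXd : HasStrictFDerivAt X (fderiv ℝ X y₀) y₀ := hX.hasStrictFDerivAt (by simp)
  have hΓd : HasStrictFDerivAt Γ (fderiv ℝ Γ y₀) y₀ := hΓ.hasStrictFDerivAt (by simp)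
  -- the derivative of `Ψ y = fderiv ℝ X y (X y)`
  set Ψ : E → E := fun y ↦ fderiv ℝ X y (X y) with hΨ
  obtain ⟨Ψ', hΨd, hΨw⟩ : ∃ Ψ' : E →L[ℝ] E, HasStrictFDerivAt Ψ Ψ' y₀ ∧
      Ψ' w = -(fderiv ℝ Γ y₀ w v v + Γ y₀ w₁ v + Γ y₀ v w₁) := by
    have h1 := ((hΓd.clm_apply hXd).clm_apply hXd).neg
    refine ⟨_, h1.congr_of_eventuallyEq ?_, ?_⟩
    · filter_upwards [hXX] with y hy
      exact (eq_neg_of_add_eq_zero_left hy).symm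
    · simp [hw₁, hv]; abel
  -- points of the variation
  set q : ℝ × ℝ → E := fun p ↦ γ p.1 + p.2 • P p.1 with hq
  have hPc : Continuous P := by fun_prop
  have hγc : Tendsto (fun p : ℝ × ℝ ↦ γ p.1) (𝓝 0) (𝓝 y₀) := by
    have : ContinuousAt (fun p : ℝ × ℝ ↦ γ p.1) 0 :=
      ContinuousAt.comp (g := γ) (f := Prod.fst) hγ0.continuousAt continuousAt_fst
    exact this
  have hqc : Tendsto q (𝓝 0) (𝓝 y₀) := by
    have h2 : Tendsto (fun p : ℝ × ℝ ↦ p.2 • P p.1) (𝓝 0) (𝓝 0) := by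
      have : Continuous (fun p : ℝ × ℝ ↦ p.2 • P p.1) := by fun_prop
      simpa using this.tendsto 0
    simpa using hγc.add h2
  have hfst : Tendsto (fun p : ℝ × ℝ ↦ p.1) (𝓝 0) (𝓝 0) := by
    simpa using (continuous_fst (X := ℝ) (Y := ℝ)).tendsto 0
  have hqO : (fun p : ℝ × ℝ ↦ q p - γ p.1) =O[𝓝 0] fun p ↦ p.2 := by
    have : (fun p : ℝ × ℝ ↦ p.2 • P p.1) =O[𝓝 0] fun p ↦ p.2 • (1 : ℝ) := by
      refine (isBigO_refl _ _).smul ?_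
      have : Tendsto (fun p : ℝ × ℝ ↦ P p.1) (𝓝 0) (𝓝 (P 0)) := (hPc.tendsto 0).comp hfst
      exact this.isBigO_one ℝ
    simpa [hq] using this
  have hpair : Tendsto (fun p : ℝ × ℝ ↦ (q p, γ p.1)) (𝓝 0) (𝓝 (y₀, y₀)) :=
    hqc.prodMk_nhds hγc
  have hPo : ∀ L : E →L[ℝ] E,
      (fun p : ℝ × ℝ ↦ L (q p - γ p.1) - p.2 • L w) =o[𝓝 0] fun p ↦ p.2 := by
    intro L
    have h1 : (fun p : ℝ × ℝ ↦ p.2 • (L (P p.1) - L w)) =o[𝓝 0] fun p ↦ p.2 • (1 : ℝ) := by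
      refine (isBigO_refl _ _).smul_isLittleO ?_
      rw [isLittleO_one_iff]
      have : Continuous (fun p : ℝ × ℝ ↦ L (P p.1) - L w) := by fun_prop
      simpa [hP] using this.tendsto 0
    simpa [hq, smul_sub] using h1
  have hstrict : ∀ {A : E → E} {A' : E →L[ℝ] E}, HasStrictFDerivAt A A' y₀ →
      (fun p : ℝ × ℝ ↦ A (q p) - A (γ p.1) - p.2 • A' w) =o[𝓝 0] fun p ↦ p.2 := by
    intro A A' hA
    have h1 := (hA.isLittleO.comp_tendsto hpair).trans_isBigO hqO
    refine (h1.add (hPo A')).congr_left fun p ↦ ?_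
    simp
  have hXev : ∀ᶠ p in 𝓝 (0 : ℝ × ℝ), DifferentiableAt ℝ X (q p) :=
    hqc.eventually ((hX.eventually (by simp)).mono fun y hy ↦ hy.differentiableAt (by simp))
  have hXev' : ∀ᶠ t in 𝓝 (0 : ℝ), DifferentiableAt ℝ X (γ t) :=
    hγ0.continuousAt.eventually
      ((hX.eventually (by simp)).mono fun y hy ↦ hy.differentiableAt (by simp))
  have hPd : ∀ t, HasDerivAt P w₁ t := fun t ↦ by
    simpa [hP] using ((hasDerivAt_id t).smul_const w₁).const_add w
  -- The mixed derivative of `X ∘ q` at the origin is computed twice: as `Ψ' w`, and as the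
  -- derivative of `-Γ(P, X)` along `γ`. The first value exists although `X` is only `C¹`, because
  -- `∇_X X = 0` turns `Ψ` into `-Γ(X, X)`.
  have hmain := hasDerivWithinAt_of_mixed_isLittleO (f := fun p ↦ X (q p))
    (g := fun p ↦ fderiv ℝ X (q p) (X (γ p.1) + p.2 • w₁))
    (k := fun t ↦ fderiv ℝ X (γ t) (P t)) (c := Ψ' w) ?_ ?_ ?_
  · have hk : (fun t ↦ fderiv ℝ X (γ t) (P t)) =ᶠ[𝓝[Set.Ici 0] 0]
        fun t ↦ -(Γ (γ t) (P t) (X (γ t))) :=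
      nhdsWithin_le_nhds (hpar.mono fun t ht ↦ eq_neg_of_add_eq_zero_left (ht _))
    have hXγ : HasDerivAt (fun t ↦ X (γ t)) (fderiv ℝ X y₀ v) 0 :=
      hXd.hasFDerivAt.comp_hasDerivAt 0 hγ0
    have hΓγ : HasDerivAt (fun t ↦ Γ (γ t)) (fderiv ℝ Γ y₀ v) 0 :=
      hΓd.hasFDerivAt.comp_hasDerivAt 0 hγ0
    have hd := ((hΓγ.clm_apply (hPd 0)).clm_apply hXγ).neg.hasDerivWithinAt (s := Set.Ici 0)
    have hd' := hd.congr_of_eventuallyEq hk (by simpa using hk.self_of_nhdsWithin (by simp))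
    have heq := (uniqueDiffWithinAt_Ici (0 : ℝ)).eq_deriv _ hmain hd'
    rw [hΨw] at heq
    have e1 : w₁ = -(Γ y₀ w v) := eq_neg_of_add_eq_zero_left (hpar.self_of_nhds w)
    have e2 : fderiv ℝ X y₀ v = -(Γ y₀ v v) := eq_neg_of_add_eq_zero_left (hpar.self_of_nhds v)
    simp only [← hy₀, e2, e1, hP, ← hv, zero_smul, add_zero, map_neg, neg_apply,
      add_apply] at heq
    -- Both sides contain the term `Γ(w₁, v)`, which cancels; what remains is `R(w, v)v = 0`.
    rw [hsymm (Γ y₀ w v) v] at heq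
    rw [← sub_eq_zero.2 (neg_injective heq)]
    abel
  · have h1 : ∀ᶠ p in 𝓝 (0 : ℝ × ℝ), HasDerivAt γ (X (γ p.1)) p.1 := hfst.eventually hγ
    filter_upwards [h1, hXev] with p hp1 hp2
    have h3 : HasDerivAt (fun t ↦ γ t + p.2 • P t) (X (γ p.1) + p.2 • w₁) p.1 :=
      hp1.add ((hPd p.1).const_smul p.2)
    exact HasFDerivAt.comp_hasDerivAt (l := X) p.1 hp2.hasFDerivAt h3
  · filter_upwards [hXev'] with t ht
    have h3 : HasDerivAt (fun ε : ℝ ↦ γ t + ε • P t) (P t) 0 := by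
      simpa using ((hasDerivAt_id (0 : ℝ)).smul_const (P t)).const_add (γ t)
    have h4 : DifferentiableAt ℝ X (γ t + (0 : ℝ) • P t) := by simpa using ht
    have := HasFDerivAt.comp_hasDerivAt (l := X) 0 h4.hasFDerivAt h3
    simpa [hq, Function.comp_def] using this
  · have h1 := hstrict hΨd
    have h2 := hstrict hXd
    have hbdd : (fun p : ℝ × ℝ ↦ fderiv ℝ X (q p)) =O[𝓝 0] fun _ ↦ (1 : ℝ) := by
      have : Tendsto (fun p : ℝ × ℝ ↦ fderiv ℝ X (q p)) (𝓝 0) (𝓝 (fderiv ℝ X y₀)) :=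
        ((hX.fderiv_right (m := 0) (by simp)).continuousAt.tendsto).comp hqc
      exact this.isBigO_one ℝ
    have h3 : (fun p : ℝ × ℝ ↦ fderiv ℝ X (q p) (X (q p) - X (γ p.1) - p.2 • w₁)) =o[𝓝 0]
        fun p ↦ p.2 := by
      have h4 : (fun p : ℝ × ℝ ↦ fderiv ℝ X (q p) (X (q p) - X (γ p.1) - p.2 • w₁)) =O[𝓝 0]
          fun p ↦ ‖fderiv ℝ X (q p)‖ * ‖X (q p) - X (γ p.1) - p.2 • w₁‖ :=
        IsBigO.of_norm_le fun p ↦ ContinuousLinearMap.le_opNorm _ _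
      refine h4.trans_isLittleO ?_
      simpa using hbdd.norm_left.mul_isLittleO h2.norm_left
    refine (h1.sub h3).congr_left fun p ↦ ?_
    simp [hq, hΨ, map_sub, map_add]
    abel

/-- A curvature-like trilinear map with `R(w, v)v = 0` vanishes. -/
theorem curvature_eq_zero_of_diagonal {R : E → E → E → E}
    (hadd₂ : ∀ u v v' w, R u (v + v') w = R u v w + R u v' w)
    (hadd₃ : ∀ u v w w', R u v (w + w') = R u v w + R u v w')
    (hanti : ∀ u v w, R u v w = -R v u w)
    (hbianchi : ∀ u v w, R u v w + R v w u + R w u v = 0)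
    (hdiag : ∀ w v, R w v v = 0) (u v w : E) : R u v w = 0 := by
  have hpol : ∀ a b c, R a b c = -R a c b := by
    intro a b c
    have := hdiag a (b + c)
    rw [hadd₂, hadd₃, hadd₃, hdiag, hdiag, zero_add, add_zero] at this
    exact eq_neg_of_add_eq_zero_left this
  -- `R` is now antisymmetric in its first two and in its last two arguments, hence invariant under
  -- cyclic permutations: the three Bianchi terms are equal.
  have h1 : R v w u = R u v w := by rw [hpol v w u, hanti v u w, neg_neg]
  have h2 : R w u v = R u v w := by rw [hanti w u v, hpol u w v, neg_neg]
  have h3 := hbianchi u v w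
  rw [h1, h2] at h3
  have h4 : (3 : ℝ) • R u v w = 0 := by rw [← h3]; module
  simpa using h4

end LocalAnalysis

/-! ### Gradients, Hessians of eikonal functions, and second-order conditions at a minimum. -/

section Gradient

variable {E : Type*} [NormedAddCommGroup E] [NormedSpace ℝ E]

/-- The gradient of `f` in coordinates. -/
noncomputable def coordGradient (G : E → E →L[ℝ] E →L[ℝ] ℝ) (f : E → ℝ) (y : E) : E :=
  (G y).inverse (fderiv ℝ f y)

theorem coordCurvature_smul (G : E → E →L[ℝ] E →L[ℝ] ℝ) (y w v : E) (c : ℝ) :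
    coordCurvature G y w (c • v) (c • v) = (c * c) • coordCurvature G y w v v := by
  simp only [coordCurvature, map_smul, smul_apply, smul_sub,
    smul_add, smul_smul]

namespace IsMetricOn

variable [FiniteDimensional ℝ E] {G : E → E →L[ℝ] E →L[ℝ] ℝ} {U : Set E} {y : E} {f : E → ℝ}

theorem apply_coordGradient (h : IsMetricOn G U) (hy : y ∈ U) (z : E) :
    G y (coordGradient G f y) z = fderiv ℝ f y z :=
  h.apply_inverse hy _ _

theorem contDiffAt_coordGradient (h : IsMetricOn G U) (hy : y ∈ U) (hf : ContDiffAt ℝ 2 f y) :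
    ContDiffAt ℝ 1 (coordGradient G f) y :=
  ((h.contDiffOn_inverse.contDiffAt (h.isOpen.mem_nhds hy)).of_le (by norm_cast)).clm_apply
    (hf.fderiv_right (m := 1) (by norm_num))

/-- The covariant derivative of the gradient is the Hessian. -/
theorem apply_fderiv_coordGradient (h : IsMetricOn G U) (hy : y ∈ U) (hf : ContDiffAt ℝ 2 f y)
    (u z : E) :
    G y (fderiv ℝ (coordGradient G f) y u + christoffel G y u (coordGradient G f y)) z =
      coordHessian G f y u z := by
  have hX : HasFDerivAt (coordGradient G f) (fderiv ℝ (coordGradient G f) y) y :=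
    ((h.contDiffAt_coordGradient hy hf).differentiableAt (by simp)).hasFDerivAt
  have hf2 : HasFDerivAt (fderiv ℝ f) (fderiv ℝ (fderiv ℝ f) y) y :=
    ((hf.fderiv_right (m := 1) (by norm_num)).differentiableAt (by simp)).hasFDerivAt
  have h1 : fderiv ℝ G y u (coordGradient G f y) z + G y (fderiv ℝ (coordGradient G f) y u) z =
      fderiv ℝ (fderiv ℝ f) y u z := by
    have e1 := ((h.differentiableAt hy).hasFDerivAt.clm_apply hX).clm_apply (hasFDerivAt_const z y)
    have e2 := hf2.clm_apply (hasFDerivAt_const z y)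
    have e3 : (fun x ↦ G x (coordGradient G f x) z) =ᶠ[𝓝 y] fun x ↦ fderiv ℝ f x z := by
      filter_upwards [h.eventually_mem hy] with x hx using h.apply_coordGradient hx z
    have := congrArg (fun L : E →L[ℝ] ℝ ↦ L u) (e1.unique (e2.congr_of_eventuallyEq e3))
    simp at this
    linarith
  have h2 : fderiv ℝ f y (christoffel G y u z) =
      (1 / 2 : ℝ) * (fderiv ℝ G y u z (coordGradient G f y) +
        fderiv ℝ G y z u (coordGradient G f y) - fderiv ℝ G y (coordGradient G f y) u z) := by
    rw [← h.apply_coordGradient hy, h.symm y hy, h.apply_christoffel hy]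
  rw [map_add, add_apply, h.apply_christoffel hy]
  simp only [coordHessian, sub_apply, ContinuousLinearMap.comp_apply,
    ContinuousLinearMap.compL_apply]
  rw [h2, h.fderiv_symm hy u z]
  linarith

theorem coordHessian_symm (h : IsMetricOn G U) (hy : y ∈ U) (hf : ContDiffAt ℝ 2 f y) (u z : E) :
    coordHessian G f y u z = coordHessian G f y z u := by
  simp only [coordHessian, sub_apply, ContinuousLinearMap.comp_apply,
    ContinuousLinearMap.compL_apply]
  rw [h.christoffel_symm hy u z, hf.isSymmSndFDerivAt (by simp) u z]

/-- If the gradient has constant length, it lies in the kernel of the Hessian. -/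
theorem coordHessian_gradient (h : IsMetricOn G U) (hy : y ∈ U) (hf : ContDiffAt ℝ 2 f y) {c : ℝ}
    (hc : ∀ᶠ x in 𝓝 y, G x (coordGradient G f x) (coordGradient G f x) = c) (z : E) :
    coordHessian G f y (coordGradient G f y) z = 0 := by
  have hX : HasFDerivAt (coordGradient G f) (fderiv ℝ (coordGradient G f) y) y :=
    ((h.contDiffAt_coordGradient hy hf).differentiableAt (by simp)).hasFDerivAt
  rw [h.coordHessian_symm hy hf, ← h.apply_fderiv_coordGradient hy hf, map_add, add_apply,
    h.apply_christoffel hy]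
  have e1 := ((h.differentiableAt hy).hasFDerivAt.clm_apply hX).clm_apply hX
  have e2 := (hasFDerivAt_const (𝕜 := ℝ) c y).congr_of_eventuallyEq hc
  have := congrArg (fun L : E →L[ℝ] ℝ ↦ L z) (e1.unique e2)
  simp at this
  rw [h.symm y hy (coordGradient G f y)] at this
  linarith

theorem fderiv_christoffel_symm (h : IsMetricOn G U) (hy : y ∈ U) (z u w : E) :
    fderiv ℝ (christoffel G) y z u w = fderiv ℝ (christoffel G) y z w u := by
  have hd : HasFDerivAt (christoffel G) (fderiv ℝ (christoffel G) y) y :=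
    ((h.contDiffAt_christoffel hy).differentiableAt (by simp)).hasFDerivAt
  have e : ∀ u w, HasFDerivAt (fun x ↦ christoffel G x u w) _ y := fun u w ↦
    (hd.clm_apply (hasFDerivAt_const u y)).clm_apply (hasFDerivAt_const w y)
  have e3 : (fun x ↦ christoffel G x u w) =ᶠ[𝓝 y] fun x ↦ christoffel G x w u := by
    filter_upwards [h.eventually_mem hy] with x hx using h.christoffel_symm hx u w
  have := congrArg (fun L : E →L[ℝ] E ↦ L z) ((e u w).unique ((e w u).congr_of_eventuallyEq e3))
  simpa using this

theorem coordCurvature_eq_zero_of_diagonal (h : IsMetricOn G U) (hy : y ∈ U)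
    (hdiag : ∀ w v, coordCurvature G y w v v = 0) (u v w : E) : coordCurvature G y u v w = 0 := by
  refine curvature_eq_zero_of_diagonal (R := coordCurvature G y) ?_ ?_ ?_ ?_ hdiag u v w
  · intro u v v' w; simp only [coordCurvature, map_add, add_apply]; abel
  · intro u v w w'; simp only [coordCurvature, map_add]; abel
  · intro u v w; simp only [coordCurvature]; abel
  · intro u v w
    simp only [coordCurvature]
    rw [h.fderiv_christoffel_symm hy u v w, h.fderiv_christoffel_symm hy v w u,
      h.fderiv_christoffel_symm hy w u v, h.christoffel_symm hy v w, h.christoffel_symm hy u v,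
      h.christoffel_symm hy u w]
    abel

/-- If `f` has gradient of unit length and its Hessian vanishes along an integral curve of
`-grad f`, then the Jacobi operator of this curve vanishes. -/
theorem coordCurvature_eq_zero_of_eikonal (h : IsMetricOn G U) {γ : ℝ → E} (hy : γ 0 ∈ U)
    (hf : ∀ᶠ x in 𝓝 (γ 0), ContDiffAt ℝ 2 f x)
    (heik : ∀ᶠ x in 𝓝 (γ 0), G x (coordGradient G f x) (coordGradient G f x) = 1)
    (hγ : ∀ᶠ t in 𝓝 0, HasDerivAt γ (-coordGradient G f (γ t)) t)
    (hess : ∀ᶠ t in 𝓝 0, coordHessian G f (γ t) = 0) (w : E) :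
    coordCurvature G (γ 0) w (coordGradient G f (γ 0)) (coordGradient G f (γ 0)) = 0 := by
  have hγc : ContinuousAt γ 0 := hγ.self_of_nhds.continuousAt
  have key := curvature_eq_zero_of_parallel_along (Γ := christoffel G)
    (X := fun x ↦ -coordGradient G f x) (γ := γ)
    ((h.contDiffAt_christoffel hy).of_le (by norm_cast)) (h.christoffel_symm hy)
    (h.contDiffAt_coordGradient hy hf.self_of_nhds).neg ?_ hγ ?_ w
  · have := coordCurvature_smul G (γ 0) w (-coordGradient G f (γ 0)) (-1)
    simp only [neg_smul, one_smul, neg_neg] at this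
    rw [this, coordCurvature, key]
    simp
  -- `∇_X X = 0` holds on a whole neighbourhood, since a gradient of constant length lies in the
  -- kernel of the Hessian.
  · filter_upwards [hf, eventually_eventually_nhds.2 heik, h.eventually_mem hy] with x hx1 hx2 hx3
    refine h.eq_of_forall hx3 fun z ↦ ?_
    have := h.apply_fderiv_coordGradient hx3 hx1 (coordGradient G f x) z
    rw [h.coordHessian_gradient hx3 hx1 hx2] at this
    simpa [fderiv_fun_neg] using this
  · filter_upwards [hγc.eventually hf, hess, hγc.eventually (h.eventually_mem hy)]
      with t ht1 ht2 ht3 u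
    refine h.eq_of_forall ht3 fun z ↦ ?_
    have := h.apply_fderiv_coordGradient ht3 ht1 u z
    rw [ht2] at this
    rw [fderiv_fun_neg, neg_apply, map_neg, ← neg_add, map_neg, neg_apply, this]
    simp

/-- A symmetric positive semidefinite form whose trace with respect to `G` vanishes is zero. -/
theorem eq_zero_of_trace_eq_zero (h : IsMetricOn G U) (hy : y ∈ U) {H : E →L[ℝ] E →L[ℝ] ℝ}
    (hsymm : ∀ u w, H u w = H w u) (hpos : ∀ u, 0 ≤ H u u)
    (htr : LinearMap.trace ℝ E (((G y).inverse ∘L H : E →L[ℝ] E) : E →ₗ[ℝ] E) = 0) : H = 0 := by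
  let B : LinearMap.BilinForm ℝ E :=
    (ContinuousLinearMap.coeLM ℝ).comp (G y : E →ₗ[ℝ] (E →L[ℝ] ℝ))
  have hB : ∀ u w, B u w = G y u w := fun _ _ ↦ rfl
  obtain ⟨e, he⟩ := LinearMap.BilinForm.exists_orthogonal_basis (B := B)
    ⟨fun u w ↦ by simpa [hB] using h.symm y hy u w⟩
  have hpe : ∀ i, 0 < G y (e i) (e i) := fun i ↦ h.pos y hy _ (e.ne_zero i)
  have hrepr : ∀ (x : E) i, e.repr x i = G y x (e i) / G y (e i) (e i) := by
    intro x i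
    rw [eq_div_iff (hpe i).ne']
    conv_rhs => rw [← e.sum_repr x]
    rw [map_sum, sum_apply, Finset.sum_eq_single i]
    · simp
    · intro j _ hji
      have := he hji
      simp only [Function.onFun, hB] at this
      simp [show G y (e j) (e i) = 0 from this]
    · simp
  -- The basis is orthogonal but not normalized, so the trace carries the denominators `G(e i, e
  -- i)`.
  have hsum : ∑ i, H (e i) (e i) / G y (e i) (e i) = 0 := by
    rw [← htr, LinearMap.trace_eq_matrix_trace ℝ e, Matrix.trace]
    refine Finset.sum_congr rfl fun i _ ↦ ?_
    rw [Matrix.diag_apply, LinearMap.toMatrix_apply, hrepr]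
    simp [h.apply_inverse hy]
  have hzero : ∀ i, H (e i) (e i) = 0 := by
    intro i
    have := (Finset.sum_eq_zero_iff_of_nonneg
      (fun i _ ↦ div_nonneg (hpos _) (hpe i).le)).1 hsum i (Finset.mem_univ i)
    rcases div_eq_zero_iff.1 this with h0 | h0
    · exact h0
    · exact absurd h0 (hpe i).ne'
  have hcs : ∀ i w, H (e i) w = 0 := by
    intro i w
    have h1 : ∀ s : ℝ, 0 ≤ 2 * s * H (e i) w + s ^ 2 * H w w := by
      intro s
      have := hpos (e i + s • w)
      simp only [map_add, map_smul, add_apply, smul_apply, smul_eq_mul, hzero, hsymm w (e i)] at this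
      nlinarith
    by_contra hne
    have hw : 0 ≤ H w w := hpos w
    -- Near the minimizer of the quadratic in `h1`; the summand `1` keeps the denominator positive
    -- when `H w w = 0`.
    have h2 := h1 (-(H (e i) w) / (1 + H w w))
    have h3 : 0 < 1 + H w w := by linarith
    have h4 : 2 * (-(H (e i) w) / (1 + H w w)) * H (e i) w +
        (-(H (e i) w) / (1 + H w w)) ^ 2 * H w w =
        -(H (e i) w) ^ 2 * (2 + H w w) / (1 + H w w) ^ 2 := by
      field_simp; ring
    rw [h4] at h2
    have h5 : 0 < (H (e i) w) ^ 2 := by positivity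
    have : -(H (e i) w) ^ 2 * (2 + H w w) / (1 + H w w) ^ 2 < 0 := by
      apply div_neg_of_neg_of_pos _ (by positivity)
      nlinarith
    linarith
  ext u w
  have : (H.flip w : E →ₗ[ℝ] ℝ) = 0 := e.ext fun i ↦ by simpa using hcs i w
  simpa using congrArg (fun L : E →ₗ[ℝ] ℝ ↦ L u) this

end IsMetricOn

/-- A negative second derivative would make `a` a local maximum as well; then `g` is constant near
`a` and its second derivative is `0`. -/
theorem deriv_deriv_nonneg_of_isLocalMin {g : ℝ → ℝ} {a : ℝ} (hg : IsLocalMin g a)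
    (hc : ContinuousAt g a) : 0 ≤ deriv (deriv g) a := by
  by_contra! hneg
  have h1 : IsLocalMax g a := isLocalMax_of_deriv_deriv_neg hneg hg.deriv_eq_zero hc
  have h2 : g =ᶠ[𝓝 a] fun _ ↦ g a := by
    filter_upwards [hg, h1] with x hx1 hx2 using le_antisymm hx2 hx1
  have h3 := h2.deriv.deriv_eq
  simp at h3
  linarith

theorem fderiv_fderiv_nonneg_of_isLocalMin {f : E → ℝ} {y : E} (hf : IsLocalMin f y)
    (hd : ContDiffAt ℝ 2 f y) (u : E) : 0 ≤ fderiv ℝ (fderiv ℝ f) y u u := by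
  have hl : ∀ s : ℝ, HasDerivAt (fun s : ℝ ↦ y + s • u) u s := fun s ↦ by
    simpa using ((hasDerivAt_id s).smul_const u).const_add y
  have hlc : Tendsto (fun s : ℝ ↦ y + s • u) (𝓝 0) (𝓝 y) := by
    simpa using (hl 0).continuousAt.tendsto
  have h1 : deriv (fun s : ℝ ↦ f (y + s • u)) =ᶠ[𝓝 0] fun s ↦ fderiv ℝ f (y + s • u) u := by
    filter_upwards [hlc.eventually (hd.eventually (by simp))] with s hs
    exact (HasFDerivAt.comp_hasDerivAt (l := f) s (hs.differentiableAt (by simp)).hasFDerivAt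
      (hl s)).deriv
  have hf2 : HasFDerivAt (fderiv ℝ f) (fderiv ℝ (fderiv ℝ f) y) (y + (0 : ℝ) • u) := by
    simpa using ((hd.fderiv_right (m := 1) (by norm_num)).differentiableAt (by simp)).hasFDerivAt
  have h2 : HasDerivAt (fun s : ℝ ↦ fderiv ℝ f (y + s • u)) _ 0 := hf2.comp_hasDerivAt 0 (hl 0)
  have h3 : deriv (deriv (fun s : ℝ ↦ f (y + s • u))) 0 = fderiv ℝ (fderiv ℝ f) y u u := by
    rw [h1.deriv_eq, (h2.clm_apply (hasDerivAt_const 0 u)).deriv]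
    simp
  rw [← h3]
  refine deriv_deriv_nonneg_of_isLocalMin ?_ ?_
  · have := hlc.eventually hf
    simpa [IsLocalMin, IsMinFilter] using this
  · have hc : ContinuousAt f (y + (0 : ℝ) • u) := by simpa using hd.continuousAt
    exact ContinuousAt.comp (g := f) hc (hl 0).continuousAt

end Gradient

/-! ### The Riemannian metric read in charts. -/

section ChartLemmas

variable {E : Type*} [NormedAddCommGroup E] [NormedSpace ℝ E]
  {M : Type*} [TopologicalSpace M] [ChartedSpace E M] [IsManifold 𝓘(ℝ, E) ∞ M]

theorem contMDiffAt_extChartAt_symm {c : M} {y : E} (hy : y ∈ (extChartAt 𝓘(ℝ, E) c).target) :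
    ContMDiffAt 𝓘(ℝ, E) 𝓘(ℝ, E) ∞ (extChartAt 𝓘(ℝ, E) c).symm y :=
  (contMDiffOn_extChartAt_symm c).contMDiffAt (extChartAt_target_mem_nhds' hy)

theorem mdifferentiableAt_extChartAt_symm {c : M} {y : E}
    (hy : y ∈ (extChartAt 𝓘(ℝ, E) c).target) :
    MDifferentiableAt 𝓘(ℝ, E) 𝓘(ℝ, E) (extChartAt 𝓘(ℝ, E) c).symm y :=
  (contMDiffAt_extChartAt_symm hy).mdifferentiableAt (by simp)

theorem contMDiffAt_extChartAt_of_mem {c x : M} (hx : x ∈ (extChartAt 𝓘(ℝ, E) c).source) :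
    ContMDiffAt 𝓘(ℝ, E) 𝓘(ℝ, E) ∞ (extChartAt 𝓘(ℝ, E) c) x :=
  contMDiffAt_extChartAt' (by simpa using hx)

theorem mdifferentiableAt_extChartAt_of_mem {c x : M} (hx : x ∈ (extChartAt 𝓘(ℝ, E) c).source) :
    MDifferentiableAt 𝓘(ℝ, E) 𝓘(ℝ, E) (extChartAt 𝓘(ℝ, E) c) x :=
  (contMDiffAt_extChartAt_of_mem hx).mdifferentiableAt (by simp)

theorem mfderiv_symm_coord {c : M} {y : E} (hy : y ∈ (extChartAt 𝓘(ℝ, E) c).target)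
    (u : TangentSpace 𝓘(ℝ, E) ((extChartAt 𝓘(ℝ, E) c).symm y)) :
    mfderiv 𝓘(ℝ, E) 𝓘(ℝ, E) (extChartAt 𝓘(ℝ, E) c).symm y
      (coord (E := E) c ((extChartAt 𝓘(ℝ, E) c).symm y) u) = u := by
  have := IsManifold.of_le (I := 𝓘(ℝ, E)) (M := M) (m := 1) (n := ∞) (by norm_cast)
  have h := mfderivWithin_extChartAt_symm_comp_mfderiv_extChartAt (I := 𝓘(ℝ, E)) (x := c) hy
  rw [modelWithCornersSelf_coe, Set.range_id, mfderivWithin_univ] at h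
  exact congrArg (fun L ↦ L u) h

theorem coord_mfderiv_symm {c : M} {y : E} (hy : y ∈ (extChartAt 𝓘(ℝ, E) c).target) (u : E) :
    coord c ((extChartAt 𝓘(ℝ, E) c).symm y)
      (mfderiv 𝓘(ℝ, E) 𝓘(ℝ, E) (extChartAt 𝓘(ℝ, E) c).symm y u) = u := by
  have := IsManifold.of_le (I := 𝓘(ℝ, E)) (M := M) (m := 1) (n := ∞) (by norm_cast)
  have h := mfderiv_extChartAt_comp_mfderivWithin_extChartAt_symm (I := 𝓘(ℝ, E)) (x := c) hy
  rw [modelWithCornersSelf_coe, Set.range_id, mfderivWithin_univ] at h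
  exact congrArg (fun L ↦ L u) h

theorem isInvertible_coord {c x : M} (hx : x ∈ (extChartAt 𝓘(ℝ, E) c).source) :
    (coord (E := E) c x).IsInvertible := by
  have := IsManifold.of_le (I := 𝓘(ℝ, E)) (M := M) (m := 1) (n := ∞) (by norm_cast)
  exact isInvertible_mfderiv_extChartAt hx

variable [RiemannianBundle (fun x : M ↦ TangentSpace 𝓘(ℝ, E) x)]

/-- The bridge between the intrinsic inner product and the coefficients in any chart around `x`, not
only the one centred at `x`. -/
theorem chartMetric_coord {c x : M} (hx : x ∈ (extChartAt 𝓘(ℝ, E) c).source)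
    (u w : TangentSpace 𝓘(ℝ, E) x) :
    chartMetric c (extChartAt 𝓘(ℝ, E) c x) (coord c x u) (coord c x w) = inner ℝ u w := by
  obtain ⟨y, hy, rfl⟩ : ∃ y ∈ (extChartAt 𝓘(ℝ, E) c).target,
      (extChartAt 𝓘(ℝ, E) c).symm y = x :=
    ⟨_, (extChartAt 𝓘(ℝ, E) c).map_source hx, (extChartAt 𝓘(ℝ, E) c).left_inv hx⟩
  rw [(extChartAt 𝓘(ℝ, E) c).right_inv hy]
  change inner ℝ (mfderiv 𝓘(ℝ, E) 𝓘(ℝ, E) (extChartAt 𝓘(ℝ, E) c).symm y _)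
    (mfderiv 𝓘(ℝ, E) 𝓘(ℝ, E) (extChartAt 𝓘(ℝ, E) c).symm y _) = _
  rw [mfderiv_symm_coord hy, mfderiv_symm_coord hy]

variable [FiniteDimensional ℝ E]
  [IsContMDiffRiemannianBundle 𝓘(ℝ, E) ∞ E (fun x : M ↦ TangentSpace 𝓘(ℝ, E) x)]

theorem isMetricOn_chartMetric (c : M) :
    IsMetricOn (chartMetric (E := E) c) (extChartAt 𝓘(ℝ, E) c).target where
  isOpen := isOpen_extChartAt_target c
  symm y _ u w := real_inner_comm (F := TangentSpace 𝓘(ℝ, E) ((extChartAt 𝓘(ℝ, E) c).symm y)) _ _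
  pos y hy u hu := by
    refine (real_inner_self_pos (F := TangentSpace 𝓘(ℝ, E) ((extChartAt 𝓘(ℝ, E) c).symm y))).2
      fun h0 ↦ hu ?_
    exact (coord_mfderiv_symm hy u).symm.trans
      ((congrArg (coord c ((extChartAt 𝓘(ℝ, E) c).symm y)) h0).trans (map_zero _))
  contDiffOn := by
    rw [contDiffOn_clm_apply]
    intro u
    rw [contDiffOn_clm_apply]
    intro w
    rw [← contMDiffOn_iff_contDiffOn]
    -- The coordinate vector fields are smooth, being the image of constant fields under the tangent
    -- map of the inverse chart.
    have hv : ∀ u : E, ContMDiffOn 𝓘(ℝ, E) 𝓘(ℝ, E).tangent ∞ (fun y : E ↦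
        (⟨(extChartAt 𝓘(ℝ, E) c).symm y, mfderiv 𝓘(ℝ, E) 𝓘(ℝ, E) (extChartAt 𝓘(ℝ, E) c).symm y u⟩ :
          TangentBundle 𝓘(ℝ, E) M)) (extChartAt 𝓘(ℝ, E) c).target := by
      intro u
      have h1 := (contMDiffOn_extChartAt_symm (I := 𝓘(ℝ, E)) (n := ∞) c).contMDiffOn_tangentMapWithin
        (m := ∞) (by simp) (isOpen_extChartAt_target c).uniqueMDiffOn
      have h2 : ContMDiff 𝓘(ℝ, E) 𝓘(ℝ, E).tangent ∞
          (fun y : E ↦ (⟨y, u⟩ : TangentBundle 𝓘(ℝ, E) E)) :=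
        contMDiff_vectorSpace_iff_contDiff.2 contDiff_const
      have h3 := h1.comp h2.contMDiffOn (s := (extChartAt 𝓘(ℝ, E) c).target) (fun y hy ↦ hy)
      refine h3.congr fun y hy ↦ ?_
      simp only [Function.comp_apply, tangentMapWithin]
      rw [mfderivWithin_of_isOpen (isOpen_extChartAt_target c) hy]
    exact ContMDiffOn.inner_bundle (F := E) (E := fun x : M ↦ TangentSpace 𝓘(ℝ, E) x) (hv u) (hv w)

end ChartLemmas

/-! ### Riemannian isometries in charts. -/

section Isometries

variable {E : Type*} [NormedAddCommGroup E] [NormedSpace ℝ E]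
  {M : Type*} [TopologicalSpace M] [ChartedSpace E M] [IsManifold 𝓘(ℝ, E) ∞ M]

variable (E) in
/-- The map `s` read in the charts centred at `c` and `c'`. -/
noncomputable def chartMap (c c' : M) (s : M → M) : E → E :=
  extChartAt 𝓘(ℝ, E) c' ∘ s ∘ (extChartAt 𝓘(ℝ, E) c).symm

theorem contDiffAt_chartMap {c c' : M} {s : M → M} (hs : ContMDiff 𝓘(ℝ, E) 𝓘(ℝ, E) ∞ s) {y : E}
    (hy : y ∈ (extChartAt 𝓘(ℝ, E) c).target)
    (hy' : s ((extChartAt 𝓘(ℝ, E) c).symm y) ∈ (extChartAt 𝓘(ℝ, E) c').source) :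
    ContDiffAt ℝ ∞ (chartMap E c c' s) y := by
  rw [← contMDiffAt_iff_contDiffAt]
  exact (contMDiffAt_extChartAt_of_mem hy').comp y
    ((hs _).comp y (contMDiffAt_extChartAt_symm hy))

theorem fderiv_chartMap {c c' : M} {s : M → M} (hs : ContMDiff 𝓘(ℝ, E) 𝓘(ℝ, E) ∞ s) {y : E}
    (hy : y ∈ (extChartAt 𝓘(ℝ, E) c).target)
    (hy' : s ((extChartAt 𝓘(ℝ, E) c).symm y) ∈ (extChartAt 𝓘(ℝ, E) c').source) (u : E) :
    fderiv ℝ (chartMap E c c' s) y u = coord c' (s ((extChartAt 𝓘(ℝ, E) c).symm y))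
      (mfderiv 𝓘(ℝ, E) 𝓘(ℝ, E) s ((extChartAt 𝓘(ℝ, E) c).symm y)
        (mfderiv 𝓘(ℝ, E) 𝓘(ℝ, E) (extChartAt 𝓘(ℝ, E) c).symm y u)) := by
  have h1 := ((hs ((extChartAt 𝓘(ℝ, E) c).symm y)).mdifferentiableAt (by simp)).hasMFDerivAt.comp y
    (mdifferentiableAt_extChartAt_symm hy).hasMFDerivAt
  have h2 := (mdifferentiableAt_extChartAt_of_mem hy').hasMFDerivAt.comp y h1
  rw [← mfderiv_eq_fderiv]
  have h3 := h2.mfderiv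
  exact congrArg (fun L ↦ L u) h3

variable [RiemannianBundle (fun x : M ↦ TangentSpace 𝓘(ℝ, E) x)]

variable (E) in
/-- Smooth maps preserving the Riemannian metric. -/
structure IsRiemannianIsometry (s : M → M) : Prop where
  contMDiff : ContMDiff 𝓘(ℝ, E) 𝓘(ℝ, E) ∞ s
  inner_mfderiv : ∀ (x : M) (u w : TangentSpace 𝓘(ℝ, E) x),
    inner ℝ (mfderiv 𝓘(ℝ, E) 𝓘(ℝ, E) s x u) (mfderiv 𝓘(ℝ, E) 𝓘(ℝ, E) s x w) = inner ℝ u w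

namespace IsRiemannianIsometry

/-- Read in two different charts, the identity is the change of charts. Invariance under isometries
therefore contains independence of the chart. -/
theorem id : IsRiemannianIsometry E (fun x : M ↦ x) where
  contMDiff := contMDiff_id
  inner_mfderiv x u w := by
    have : mfderiv 𝓘(ℝ, E) 𝓘(ℝ, E) (fun x : M ↦ x) x = ContinuousLinearMap.id ℝ _ := mfderiv_id
    rw [this]; rfl

theorem comp {s s' : M → M} (hs : IsRiemannianIsometry E s) (hs' : IsRiemannianIsometry E s') :
    IsRiemannianIsometry E (s ∘ s') where
  contMDiff := hs.contMDiff.comp hs'.contMDiff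
  inner_mfderiv x u w := by
    rw [mfderiv_comp x ((hs.contMDiff _).mdifferentiableAt (by simp))
      ((hs'.contMDiff _).mdifferentiableAt (by simp))]
    exact (hs.inner_mfderiv _ _ _).trans (hs'.inner_mfderiv _ _ _)

theorem norm_mfderiv {s : M → M} (hs : IsRiemannianIsometry E s) (x : M)
    (u : TangentSpace 𝓘(ℝ, E) x) : ‖mfderiv 𝓘(ℝ, E) 𝓘(ℝ, E) s x u‖ = ‖u‖ := by
  rw [@norm_eq_sqrt_real_inner (TangentSpace 𝓘(ℝ, E) (s x)),
    @norm_eq_sqrt_real_inner (TangentSpace 𝓘(ℝ, E) x), hs.inner_mfderiv]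

theorem chartMetric_eq {s : M → M} (hs : IsRiemannianIsometry E s) {c c' : M} {y : E}
    (hy : y ∈ (extChartAt 𝓘(ℝ, E) c).target)
    (hy' : s ((extChartAt 𝓘(ℝ, E) c).symm y) ∈ (extChartAt 𝓘(ℝ, E) c').source) (u w : E) :
    chartMetric c y u w = chartMetric c' (chartMap E c c' s y)
      (fderiv ℝ (chartMap E c c' s) y u) (fderiv ℝ (chartMap E c c' s) y w) := by
  rw [fderiv_chartMap hs.contMDiff hy hy', fderiv_chartMap hs.contMDiff hy hy']
  exact ((chartMetric_coord hy' _ _).trans (hs.inner_mfderiv _ _ _)).symm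

variable {s : M → M} {c c' : M} {y : E}

theorem eventually_chartMetric_eq (hs : IsRiemannianIsometry E s)
    (hy : y ∈ (extChartAt 𝓘(ℝ, E) c).target)
    (hy' : s ((extChartAt 𝓘(ℝ, E) c).symm y) ∈ (extChartAt 𝓘(ℝ, E) c').source) :
    ∀ᶠ x in 𝓝 y, ∀ u w, chartMetric c x u w = chartMetric c' (chartMap E c c' s x)
      (fderiv ℝ (chartMap E c c' s) x u) (fderiv ℝ (chartMap E c c' s) x w) := by
  have h1 : ContinuousAt (s ∘ (extChartAt 𝓘(ℝ, E) c).symm) y :=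
    hs.contMDiff.continuous.continuousAt.comp (continuousAt_extChartAt_symm'' hy)
  filter_upwards [extChartAt_target_mem_nhds' hy,
    h1.eventually ((isOpen_extChartAt_source (I := 𝓘(ℝ, E)) c').mem_nhds hy')] with x hx hx'
  exact hs.chartMetric_eq hx hx'

variable [FiniteDimensional ℝ E]
  [IsContMDiffRiemannianBundle 𝓘(ℝ, E) ∞ E (fun x : M ↦ TangentSpace 𝓘(ℝ, E) x)]

theorem surjective_fderiv_chartMap (hs : IsRiemannianIsometry E s)
    (hy : y ∈ (extChartAt 𝓘(ℝ, E) c).target)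
    (hy' : s ((extChartAt 𝓘(ℝ, E) c).symm y) ∈ (extChartAt 𝓘(ℝ, E) c').source) :
    Function.Surjective (fderiv ℝ (chartMap E c c' s) y) := by
  refine (LinearMap.injective_iff_surjective (f := (fderiv ℝ (chartMap E c c' s) y).toLinearMap)).1 ?_
  refine (injective_iff_map_eq_zero _).2 fun u hu ↦ ?_
  by_contra hne
  have h1 := (isMetricOn_chartMetric (E := E) c).pos y hy u hne
  have hu' : fderiv ℝ (chartMap E c c' s) y u = 0 := hu
  rw [hs.chartMetric_eq hy hy', hu'] at h1
  simp at h1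

/-- Isometries preserve the Hessian. -/
theorem coordHessian_chartMap (hs : IsRiemannianIsometry E s)
    (hy : y ∈ (extChartAt 𝓘(ℝ, E) c).target)
    (hy' : s ((extChartAt 𝓘(ℝ, E) c).symm y) ∈ (extChartAt 𝓘(ℝ, E) c').source) {f : E → ℝ}
    (hf : ContDiffAt ℝ 2 f (chartMap E c c' s y)) (u w : E) :
    coordHessian (chartMetric c) (f ∘ chartMap E c c' s) y u w =
      coordHessian (chartMetric c') f (chartMap E c c' s y)
        (fderiv ℝ (chartMap E c c' s) y u) (fderiv ℝ (chartMap E c c' s) y w) :=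
  (isMetricOn_chartMetric c).coordHessian_comp hy (isMetricOn_chartMetric c')
    ((extChartAt 𝓘(ℝ, E) c').map_source hy')
    ((contDiffAt_chartMap hs.contMDiff hy hy').of_le (by norm_cast))
    (hs.eventually_chartMetric_eq hy hy') (hs.surjective_fderiv_chartMap hy hy') hf u w

end IsRiemannianIsometry

end Isometries

/-! ### The geodesic equation, pointwise in the parameter. -/

section GeodesicEquation

variable {E : Type*} [NormedAddCommGroup E] [NormedSpace ℝ E]
  {M : Type*} [MetricSpace M] [ChartedSpace E M] [IsManifold 𝓘(ℝ, E) ∞ M]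

theorem contDiffAt_extChartAt_comp {γ : ℝ → M} {t : ℝ} {c : M} {n : WithTop ℕ∞} (hn : n ≤ ∞)
    (hγ : ContMDiffAt 𝓘(ℝ, ℝ) 𝓘(ℝ, E) n γ t) (hc : γ t ∈ (extChartAt 𝓘(ℝ, E) c).source) :
    ContDiffAt ℝ n (extChartAt 𝓘(ℝ, E) c ∘ γ) t := by
  rw [← contMDiffAt_iff_contDiffAt]
  exact ((contMDiffAt_extChartAt_of_mem hc).of_le hn).comp t hγ

theorem coord_velocity {γ : ℝ → M} {t : ℝ} {c : M}
    (hγ : MDifferentiableAt 𝓘(ℝ, ℝ) 𝓘(ℝ, E) γ t) (hc : γ t ∈ (extChartAt 𝓘(ℝ, E) c).source) :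
    coord c (γ t) (velocity E γ t) = deriv (extChartAt 𝓘(ℝ, E) c ∘ γ) t := by
  have h := ((mdifferentiableAt_extChartAt_of_mem hc).hasMFDerivAt.comp t hγ.hasMFDerivAt).mfderiv
  rw [← fderiv_apply_one_eq_deriv, ← mfderiv_eq_fderiv]
  exact (congrArg (fun L ↦ L (1 : ℝ)) h).symm

variable [RiemannianBundle (fun x : M ↦ TangentSpace 𝓘(ℝ, E) x)]

variable (E) in
/-- `γ` is smooth at `t` and satisfies the geodesic equation at `t`. -/
structure IsGeodesicAt (γ : ℝ → M) (t : ℝ) : Prop where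
  contMDiffAt : ContMDiffAt 𝓘(ℝ, ℝ) 𝓘(ℝ, E) ∞ γ t
  coordAccel_eq_zero : coordAccel (chartMetric (γ t)) (extChartAt 𝓘(ℝ, E) (γ t) ∘ γ) t = 0

theorem covDerivAlong_velocity_eq_zero_iff {γ : ℝ → M} {t : ℝ}
    (hγ : ContMDiffAt 𝓘(ℝ, ℝ) 𝓘(ℝ, E) ∞ γ t) :
    covDerivAlong γ (velocity E γ) t = 0 ↔
      coordAccel (chartMetric (γ t)) (extChartAt 𝓘(ℝ, E) (γ t) ∘ γ) t = 0 := by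
  have hsrc : ∀ᶠ s in 𝓝 t, γ s ∈ (extChartAt 𝓘(ℝ, E) (γ t)).source :=
    hγ.continuousAt.eventually (extChartAt_source_mem_nhds (γ t))
  have hd : ∀ᶠ s in 𝓝 t, MDifferentiableAt 𝓘(ℝ, ℝ) 𝓘(ℝ, E) γ s := by
    have h1 : ContMDiffAt 𝓘(ℝ, ℝ) 𝓘(ℝ, E) 1 γ t := hγ.of_le (by norm_cast)
    filter_upwards [(contMDiffAt_iff_contMDiffAt_nhds (by simp)).1 h1] with s hs using hs.mdifferentiableAt (by simp)
  have heq : (fun s ↦ coord (γ t) (γ s) (velocity E γ s)) =ᶠ[𝓝 t]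
      deriv (extChartAt 𝓘(ℝ, E) (γ t) ∘ γ) := by
    filter_upwards [hsrc, hd] with s hs1 hs2 using coord_velocity hs2 hs1
  have hinv := isInvertible_coord (E := E) (mem_extChartAt_source (I := 𝓘(ℝ, E)) (γ t))
  rw [covDerivAlong, hinv.inverse_apply_eq, map_zero, heq.deriv_eq,
    show coord (γ t) (γ t) (velocity E γ t) = _ from heq.self_of_nhds]
  rfl

/-- The pointwise form allows geodesics defined only on an interval to be maps `ℝ → M` with
arbitrary values elsewhere, and to be glued. -/
theorem isGeodesic_iff {γ : ℝ → M} : IsGeodesic E γ ↔ ∀ t, IsGeodesicAt E γ t :=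
  ⟨fun h t ↦ ⟨h.contMDiff t, (covDerivAlong_velocity_eq_zero_iff (h.contMDiff t)).1
    (h.covDeriv_velocity t)⟩, fun h ↦ ⟨fun t ↦ (h t).contMDiffAt, fun t ↦
    (covDerivAlong_velocity_eq_zero_iff (h t).contMDiffAt).2 (h t).coordAccel_eq_zero⟩⟩

theorem IsGeodesicAt.congr {γ γ' : ℝ → M} {t : ℝ} (h : IsGeodesicAt E γ t) (heq : γ' =ᶠ[𝓝 t] γ) :
    IsGeodesicAt E γ' t where
  contMDiffAt := h.contMDiffAt.congr_of_eventuallyEq heq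
  coordAccel_eq_zero := by
    rw [heq.self_of_nhds]
    have h1 : extChartAt 𝓘(ℝ, E) (γ t) ∘ γ' =ᶠ[𝓝 t] extChartAt 𝓘(ℝ, E) (γ t) ∘ γ :=
      heq.fun_comp _
    rw [coordAccel, h1.deriv.deriv_eq, h1.deriv.self_of_nhds, h1.self_of_nhds]
    exact h.coordAccel_eq_zero

theorem IsGeodesicAt.comp_add {γ : ℝ → M} {t a : ℝ} (h : IsGeodesicAt E γ (t + a)) :
    IsGeodesicAt E (fun s ↦ γ (s + a)) t where
  contMDiffAt := by
    have h1 : ContMDiff 𝓘(ℝ, ℝ) 𝓘(ℝ, ℝ) ∞ (fun s : ℝ ↦ s + a) := by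
      rw [contMDiff_iff_contDiff]; fun_prop
    exact ContMDiffAt.comp t (g := γ) (f := fun s : ℝ ↦ s + a) h.contMDiffAt (h1 t)
  coordAccel_eq_zero := by
    rw [← h.coordAccel_eq_zero]
    have h1 : ∀ f : ℝ → E, deriv (fun s ↦ f (s + a)) = fun s ↦ deriv f (s + a) := fun f ↦ by
      ext s; rw [deriv_comp_add_const]
    simp only [coordAccel, Function.comp_def, h1 (fun s ↦ extChartAt 𝓘(ℝ, E) (γ (t + a)) (γ s)), h1]

theorem IsGeodesicAt.comp_neg {γ : ℝ → M} {t : ℝ} (h : IsGeodesicAt E γ (-t)) :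
    IsGeodesicAt E (fun s ↦ γ (-s)) t where
  contMDiffAt := by
    have h1 : ContMDiff 𝓘(ℝ, ℝ) 𝓘(ℝ, ℝ) ∞ (fun s : ℝ ↦ -s) := by
      rw [contMDiff_iff_contDiff]; fun_prop
    exact ContMDiffAt.comp t (g := γ) (f := fun s : ℝ ↦ -s) h.contMDiffAt (h1 t)
  coordAccel_eq_zero := by
    rw [← h.coordAccel_eq_zero]
    have h1 : ∀ f : ℝ → E, deriv (fun s ↦ f (-s)) = fun s ↦ -deriv f (-s) := fun f ↦ by
      ext s; rw [deriv_comp_neg]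
    simp only [coordAccel, Function.comp_def, h1 (fun s ↦ extChartAt 𝓘(ℝ, E) (γ (-t)) (γ s)),
      deriv.fun_neg, h1, map_neg, neg_neg, neg_apply]

variable [FiniteDimensional ℝ E]
  [IsContMDiffRiemannianBundle 𝓘(ℝ, E) ∞ E (fun x : M ↦ TangentSpace 𝓘(ℝ, E) x)]

theorem IsRiemannianIsometry.coordAccel_eq_zero {s : M → M} (hs : IsRiemannianIsometry E s)
    {c c' : M} {γ : ℝ → M} {t : ℝ} (hγ : ContMDiffAt 𝓘(ℝ, ℝ) 𝓘(ℝ, E) ∞ γ t)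
    (hc : γ t ∈ (extChartAt 𝓘(ℝ, E) c).source) (hc' : s (γ t) ∈ (extChartAt 𝓘(ℝ, E) c').source)
    (h : coordAccel (chartMetric c) (extChartAt 𝓘(ℝ, E) c ∘ γ) t = 0) :
    coordAccel (chartMetric c') (extChartAt 𝓘(ℝ, E) c' ∘ s ∘ γ) t = 0 := by
  have hy : (extChartAt 𝓘(ℝ, E) c ∘ γ) t ∈ (extChartAt 𝓘(ℝ, E) c).target :=
    (extChartAt 𝓘(ℝ, E) c).map_source hc
  have hy' : s ((extChartAt 𝓘(ℝ, E) c).symm ((extChartAt 𝓘(ℝ, E) c ∘ γ) t)) ∈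
      (extChartAt 𝓘(ℝ, E) c').source := by
    rwa [Function.comp_apply, (extChartAt 𝓘(ℝ, E) c).left_inv hc]
  have h1 := (isMetricOn_chartMetric (E := E) c).coordAccel_comp hy (isMetricOn_chartMetric c')
    ((extChartAt 𝓘(ℝ, E) c').map_source hy')
    ((contDiffAt_chartMap hs.contMDiff hy hy').of_le (by norm_cast))
    (hs.eventually_chartMetric_eq hy hy') (hs.surjective_fderiv_chartMap hy hy')
    ((contDiffAt_extChartAt_comp le_rfl hγ hc).of_le (by norm_cast))
  rw [h, map_zero] at h1
  have heq : extChartAt 𝓘(ℝ, E) c' ∘ s ∘ γ =ᶠ[𝓝 t]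
      chartMap E c c' s ∘ (extChartAt 𝓘(ℝ, E) c ∘ γ) := by
    filter_upwards [hγ.continuousAt.eventually (extChartAt_source_mem_nhds' hc)] with r hr
    simp only [chartMap, Function.comp_apply]
    rw [(extChartAt 𝓘(ℝ, E) c).left_inv hr]
  rw [coordAccel, heq.deriv.deriv_eq, heq.deriv.self_of_nhds, heq.self_of_nhds]
  exact h1

theorem IsGeodesicAt.comp_isometry {γ : ℝ → M} {t : ℝ} (h : IsGeodesicAt E γ t) {s : M → M}
    (hs : IsRiemannianIsometry E s) : IsGeodesicAt E (s ∘ γ) t where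
  contMDiffAt := (hs.contMDiff _).comp t h.contMDiffAt
  coordAccel_eq_zero := hs.coordAccel_eq_zero h.contMDiffAt (mem_extChartAt_source _)
    (mem_extChartAt_source _) h.coordAccel_eq_zero

theorem isGeodesicAt_iff {γ : ℝ → M} {t : ℝ} {c : M} (hc : γ t ∈ (extChartAt 𝓘(ℝ, E) c).source) :
    IsGeodesicAt E γ t ↔ ContMDiffAt 𝓘(ℝ, ℝ) 𝓘(ℝ, E) ∞ γ t ∧
      coordAccel (chartMetric c) (extChartAt 𝓘(ℝ, E) c ∘ γ) t = 0 :=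
  ⟨fun h ↦ ⟨h.contMDiffAt, IsRiemannianIsometry.id.coordAccel_eq_zero h.contMDiffAt
    (mem_extChartAt_source _) hc h.coordAccel_eq_zero⟩,
   fun h ↦ ⟨h.1, IsRiemannianIsometry.id.coordAccel_eq_zero h.1 hc
    (mem_extChartAt_source _) h.2⟩⟩

end GeodesicEquation

/-! ### The geodesic vector field on phase space. -/

section GeodesicField

variable {E : Type*} [NormedAddCommGroup E] [NormedSpace ℝ E]

/-- Solutions of autonomous smooth differential equations are smooth. -/
theorem contDiffOn_of_hasDerivAt_autonomous {f : E → E} {S : Set E} (hf : ContDiffOn ℝ ∞ f S)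
    {α : ℝ → E} {a b : ℝ}
    (h : ∀ t ∈ Set.Ioo a b, HasDerivAt α (f (α t)) t ∧ α t ∈ S) :
    ContDiffOn ℝ ∞ α (Set.Ioo a b) := by
  have hn : ∀ n : ℕ, ContDiffOn ℝ n α (Set.Ioo a b) := by
    intro n
    induction n with
    | zero =>
      exact contDiffOn_zero.2 fun t ht ↦ (h t ht).1.continuousAt.continuousWithinAt
    | succ n ih =>
      have := (contDiffOn_succ_iff_deriv_of_isOpen (n := (n : WithTop ℕ∞)) (f := α)
        (isOpen_Ioo (a := a) (b := b))).2
        ⟨fun t ht ↦ (h t ht).1.differentiableAt.differentiableWithinAt, by simp, ?_⟩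
      · simpa using this
      · have h1 : ContDiffOn ℝ n (f ∘ α) (Set.Ioo a b) :=
          (hf.of_le (by exact_mod_cast le_top)).comp ih fun t ht ↦ (h t ht).2
        exact h1.congr fun t ht ↦ (h t ht).1.deriv
  exact contDiffOn_infty.2 hn

/-- The geodesic equation as a first order equation in phase space. -/
noncomputable def geodesicField (G : E → E →L[ℝ] E →L[ℝ] ℝ) (q : E × E) : E × E :=
  (q.2, -christoffel G q.1 q.2 q.2)

theorem IsMetricOn.contDiffOn_geodesicField [FiniteDimensional ℝ E]
    {G : E → E →L[ℝ] E →L[ℝ] ℝ} {U : Set E} (h : IsMetricOn G U) :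
    ContDiffOn ℝ ∞ (geodesicField G) (U ×ˢ Set.univ) := by
  have h1 : ContDiffOn ℝ ∞ (fun q : E × E ↦ christoffel G q.1) (U ×ˢ Set.univ) :=
    h.contDiffOn_christoffel.comp contDiffOn_fst fun q hq ↦ hq.1
  exact contDiffOn_snd.prodMk ((h1.clm_apply contDiffOn_snd).clm_apply contDiffOn_snd).neg

theorem IsMetricOn.contDiffAt_geodesicField [FiniteDimensional ℝ E]
    {G : E → E →L[ℝ] E →L[ℝ] ℝ} {U : Set E} (h : IsMetricOn G U) {q : E × E} (hq : q.1 ∈ U) :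
    ContDiffAt ℝ ∞ (geodesicField G) q :=
  h.contDiffOn_geodesicField.contDiffAt ((h.isOpen.prod isOpen_univ).mem_nhds ⟨hq, trivial⟩)

theorem hasDerivAt_phase {G : E → E →L[ℝ] E →L[ℝ] ℝ} {y : ℝ → E} {t : ℝ}
    (hy : ContDiffAt ℝ 2 y t) (hacc : coordAccel G y t = 0) :
    HasDerivAt (fun s ↦ (y s, deriv y s)) (geodesicField G (y t, deriv y t)) t := by
  have hy1 : HasDerivAt y (deriv y t) t := (hy.differentiableAt (by simp)).hasDerivAt
  have hy2 : HasDerivAt (deriv y) (deriv (deriv y) t) t := by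
    have : ContDiffAt ℝ 1 (fun s ↦ fderiv ℝ y s 1) t :=
      (hy.fderiv_right (m := 1) (by norm_num)).clm_apply contDiffAt_const
    exact (this.differentiableAt (by simp)).hasDerivAt
  rw [eq_neg_of_add_eq_zero_left hacc] at hy2
  exact hy1.prodMk hy2

/-- The length of the velocity is infinitesimally constant along geodesics. -/
theorem IsMetricOn.hasDerivAt_speed [FiniteDimensional ℝ E] {G : E → E →L[ℝ] E →L[ℝ] ℝ} {U : Set E}
    (h : IsMetricOn G U) {y : ℝ → E} {t : ℝ} (hyU : y t ∈ U)
    (hy : ContDiffAt ℝ 2 y t) (hacc : coordAccel G y t = 0) :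
    HasDerivAt (fun s ↦ G (y s) (deriv y s) (deriv y s)) 0 t := by
  have h1 := hasDerivAt_phase hy hacc
  have hy1 : HasDerivAt y (deriv y t) t := (hy.differentiableAt (by simp)).hasDerivAt
  have hy2 : HasDerivAt (deriv y) (-christoffel G (y t) (deriv y t) (deriv y t)) t := h1.snd
  have hG : HasDerivAt (fun s ↦ G (y s)) (fderiv ℝ G (y t) (deriv y t)) t :=
    (h.differentiableAt hyU).hasFDerivAt.comp_hasDerivAt t hy1
  refine ((hG.clm_apply hy2).clm_apply hy2).congr_deriv ?_
  rw [map_neg, map_neg, h.symm _ hyU (deriv y t), add_apply, neg_apply, h.apply_christoffel hyU]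
  ring

end GeodesicField

/-! ### Local existence, uniqueness and constant speed of geodesics. -/

section LocalGeodesics

variable {E : Type*} [NormedAddCommGroup E] [NormedSpace ℝ E] [FiniteDimensional ℝ E]
  {M : Type*} [MetricSpace M] [ChartedSpace E M] [IsManifold 𝓘(ℝ, E) ∞ M]
  [RiemannianBundle (fun x : M ↦ TangentSpace 𝓘(ℝ, E) x)]
  [IsContMDiffRiemannianBundle 𝓘(ℝ, E) ∞ E (fun x : M ↦ TangentSpace 𝓘(ℝ, E) x)]

theorem IsGeodesicAt.hasDerivAt_phase {γ : ℝ → M} {t : ℝ} {c : M}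
    (h : IsGeodesicAt E γ t) (hc : γ t ∈ (extChartAt 𝓘(ℝ, E) c).source) :
    HasDerivAt (fun s ↦ ((extChartAt 𝓘(ℝ, E) c ∘ γ) s, deriv (extChartAt 𝓘(ℝ, E) c ∘ γ) s))
      (geodesicField (chartMetric c) ((extChartAt 𝓘(ℝ, E) c ∘ γ) t,
        deriv (extChartAt 𝓘(ℝ, E) c ∘ γ) t)) t :=
  RiemGeom.hasDerivAt_phase
    ((contDiffAt_extChartAt_comp le_rfl h.contMDiffAt hc).of_le (by norm_cast))
    ((isGeodesicAt_iff hc).1 h).2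

theorem eventuallyEq_of_isGeodesicAt {γ₁ γ₂ : ℝ → M} {t : ℝ} {c : M}
    (h₁ : ∀ᶠ s in 𝓝 t, IsGeodesicAt E γ₁ s) (h₂ : ∀ᶠ s in 𝓝 t, IsGeodesicAt E γ₂ s)
    (hc : γ₁ t ∈ (extChartAt 𝓘(ℝ, E) c).source) (heq : γ₁ t = γ₂ t)
    (hderiv : deriv (extChartAt 𝓘(ℝ, E) c ∘ γ₁) t = deriv (extChartAt 𝓘(ℝ, E) c ∘ γ₂) t) :
    γ₁ =ᶠ[𝓝 t] γ₂ := by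
  have hmet := isMetricOn_chartMetric (E := E) c
  obtain ⟨K, S, hS, hK⟩ := ((hmet.contDiffAt_geodesicField
    (q := ((extChartAt 𝓘(ℝ, E) c ∘ γ₁) t, deriv (extChartAt 𝓘(ℝ, E) c ∘ γ₁) t))
    ((extChartAt 𝓘(ℝ, E) c).map_source hc)).of_le (m := 1) (by norm_cast)).exists_lipschitzOnWith
  have hsrc₁ : ∀ᶠ s in 𝓝 t, γ₁ s ∈ (extChartAt 𝓘(ℝ, E) c).source :=
    h₁.self_of_nhds.contMDiffAt.continuousAt.eventually (extChartAt_source_mem_nhds' hc)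
  have hsrc₂ : ∀ᶠ s in 𝓝 t, γ₂ s ∈ (extChartAt 𝓘(ℝ, E) c).source :=
    h₂.self_of_nhds.contMDiffAt.continuousAt.eventually (extChartAt_source_mem_nhds' (heq ▸ hc))
  have hd₁ := h₁.self_of_nhds.hasDerivAt_phase hc
  have hd₂ := h₂.self_of_nhds.hasDerivAt_phase (c := c) (heq ▸ hc)
  have hpt : ((extChartAt 𝓘(ℝ, E) c ∘ γ₁) t, deriv (extChartAt 𝓘(ℝ, E) c ∘ γ₁) t) =
      ((extChartAt 𝓘(ℝ, E) c ∘ γ₂) t, deriv (extChartAt 𝓘(ℝ, E) c ∘ γ₂) t) := by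
    rw [hderiv, Function.comp_apply, Function.comp_apply, heq]
  have key := ODE_solution_unique_of_eventually (v := fun _ ↦ geodesicField (chartMetric c))
    (s := fun _ ↦ S) (K := K) (t₀ := t)
    (f := fun s ↦ ((extChartAt 𝓘(ℝ, E) c ∘ γ₁) s, deriv (extChartAt 𝓘(ℝ, E) c ∘ γ₁) s))
    (g := fun s ↦ ((extChartAt 𝓘(ℝ, E) c ∘ γ₂) s, deriv (extChartAt 𝓘(ℝ, E) c ∘ γ₂) s))
    (Eventually.of_forall fun _ ↦ hK) ?_ ?_ hpt
  · filter_upwards [key, hsrc₁, hsrc₂] with s hs hs₁ hs₂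
    exact (extChartAt 𝓘(ℝ, E) c).injOn hs₁ hs₂ (congrArg Prod.fst hs)
  · filter_upwards [h₁, hsrc₁, hd₁.continuousAt.eventually hS] with s hs hs' hsS
    exact ⟨hs.hasDerivAt_phase hs', hsS⟩
  · have hS' := hS
    rw [hpt] at hS'
    filter_upwards [h₂, hsrc₂, hd₂.continuousAt.eventually hS'] with s hs hs' hsS
    exact ⟨hs.hasDerivAt_phase hs', hsS⟩

/-- Geodesics which agree near one parameter agree on a common interval of definition. -/
theorem eqOn_of_isGeodesicAt {γ₁ γ₂ : ℝ → M} {S : Set ℝ} (hS : IsOpen S) (hS' : IsPreconnected S)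
    (h₁ : ∀ s ∈ S, IsGeodesicAt E γ₁ s) (h₂ : ∀ s ∈ S, IsGeodesicAt E γ₂ s) {t : ℝ} (ht : t ∈ S)
    (heq : γ₁ =ᶠ[𝓝 t] γ₂) : Set.EqOn γ₁ γ₂ S := by
  -- The set where the germs agree is open, and relatively closed in `S`: position and velocity pass
  -- to the limit, and local uniqueness applies there.
  have hsub : S ⊆ {s | γ₁ =ᶠ[𝓝 s] γ₂} := by
    refine hS'.subset_of_closure_inter_subset ?_ ⟨t, ht, heq⟩ ?_
    · exact isOpen_iff_mem_nhds.2 fun s hs ↦ eventually_eventually_nhds.2 hs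
    · rintro r ⟨hr, hrS⟩
      have hfr : ∃ᶠ s in 𝓝 r, γ₁ =ᶠ[𝓝 s] γ₂ := mem_closure_iff_frequently.1 hr
      have hc₁ := (h₁ r hrS).contMDiffAt.continuousAt
      have hc₂ := (h₂ r hrS).contMDiffAt.continuousAt
      have hval : γ₁ r = γ₂ r := by
        refine tendsto_nhds_unique_of_frequently_eq hc₁ hc₂ (hfr.mono fun s hs ↦ hs.self_of_nhds)
      have hsrc := mem_extChartAt_source (I := 𝓘(ℝ, E)) (γ₁ r)
      have hd₁ := ((h₁ r hrS).hasDerivAt_phase hsrc).continuousAt.snd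
      have hd₂ := ((h₂ r hrS).hasDerivAt_phase (c := γ₁ r) (hval ▸ hsrc)).continuousAt.snd
      have hder : deriv (extChartAt 𝓘(ℝ, E) (γ₁ r) ∘ γ₁) r =
          deriv (extChartAt 𝓘(ℝ, E) (γ₁ r) ∘ γ₂) r :=
        tendsto_nhds_unique_of_frequently_eq hd₁ hd₂
          (hfr.mono fun s hs ↦ (hs.fun_comp (extChartAt 𝓘(ℝ, E) (γ₁ r))).deriv_eq)
      exact eventuallyEq_of_isGeodesicAt
        (Filter.eventually_of_mem (hS.mem_nhds hrS) h₁)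
        (Filter.eventually_of_mem (hS.mem_nhds hrS) h₂) hsrc hval hder
  exact fun s hs ↦ (hsub hs).self_of_nhds

/-- Local existence of geodesics. -/
theorem exists_isGeodesicAt (p : M) (v : E) : ∃ (γ : ℝ → M) (ε : ℝ), 0 < ε ∧ γ 0 = p ∧
    deriv (extChartAt 𝓘(ℝ, E) p ∘ γ) 0 = v ∧ ∀ t ∈ Set.Ioo (-ε) ε, IsGeodesicAt E γ t := by
  have := FiniteDimensional.complete ℝ E
  have hmet := isMetricOn_chartMetric (E := E) p
  have hp := mem_extChartAt_source (I := 𝓘(ℝ, E)) p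
  have hpt : extChartAt 𝓘(ℝ, E) p p ∈ (extChartAt 𝓘(ℝ, E) p).target :=
    (extChartAt 𝓘(ℝ, E) p).map_source hp
  obtain ⟨α, hα0, ε, hε, hα⟩ := ((hmet.contDiffAt_geodesicField
    (q := (extChartAt 𝓘(ℝ, E) p p, v)) hpt).of_le (m := 1)
    (by norm_cast)).exists_forall_mem_closedBall_exists_eq_forall_mem_Ioo_hasDerivAt₀ 0
  simp only [zero_sub, zero_add] at hα
  have hc : ContinuousAt α 0 := (hα 0 ⟨by linarith, hε⟩).continuousAt
  have hnear : ∀ᶠ t in 𝓝 0, (α t).1 ∈ (extChartAt 𝓘(ℝ, E) p).target :=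
    hc.fst.eventually (by simp only [hα0]; exact hmet.isOpen.mem_nhds hpt)
  obtain ⟨δ, hδ, hball⟩ := Metric.eventually_nhds_iff.1 hnear
  -- `δ` keeps the solution inside the chart, where the equation is the geodesic equation of the
  -- manifold.
  set r := min ε δ
  have hr0 : 0 < r := lt_min hε hδ
  have hin : ∀ t ∈ Set.Ioo (-r) r, HasDerivAt α (geodesicField (chartMetric p) (α t)) t ∧
      α t ∈ (extChartAt 𝓘(ℝ, E) p).target ×ˢ (Set.univ : Set E) := by
    intro t ht
    refine ⟨hα t ⟨?_, ht.2.trans_le (min_le_left _ _)⟩, hball ?_, trivial⟩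
    · linarith [ht.1, min_le_left ε δ]
    · rw [Real.dist_eq, sub_zero]
      exact (abs_lt.2 ht).trans_le (min_le_right _ _)
  have hsm := contDiffOn_of_hasDerivAt_autonomous hmet.contDiffOn_geodesicField hin
  refine ⟨fun t ↦ (extChartAt 𝓘(ℝ, E) p).symm (α t).1, r, hr0, ?_, ?_, ?_⟩
  · simp only [hα0]
    exact (extChartAt 𝓘(ℝ, E) p).left_inv hp
  all_goals
    have hco : ∀ t ∈ Set.Ioo (-r) r,
        (extChartAt 𝓘(ℝ, E) p ∘ fun t ↦ (extChartAt 𝓘(ℝ, E) p).symm (α t).1) =ᶠ[𝓝 t]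
          fun t ↦ (α t).1 := by
      intro t ht
      filter_upwards [Ioo_mem_nhds ht.1 ht.2] with s hs
      exact (extChartAt 𝓘(ℝ, E) p).right_inv (hin s hs).2.1
    have hd : ∀ t ∈ Set.Ioo (-r) r, deriv (fun t ↦ (α t).1) t = (α t).2 :=
      fun t ht ↦
        ((ContinuousLinearMap.fst ℝ E E).hasFDerivAt.comp_hasDerivAt t (hin t ht).1).deriv
  · have h0 : (0 : ℝ) ∈ Set.Ioo (-r) r := ⟨by linarith, hr0⟩
    rw [(hco 0 h0).deriv_eq, hd 0 h0, hα0]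
  · intro t ht
    have hnh := Ioo_mem_nhds ht.1 ht.2
    refine (isGeodesicAt_iff (c := p) ((extChartAt 𝓘(ℝ, E) p).map_target (hin t ht).2.1)).2 ⟨?_, ?_⟩
    · have h1 : ContMDiffAt 𝓘(ℝ, ℝ) 𝓘(ℝ, E) ∞ (fun t ↦ (α t).1) t := by
        rw [contMDiffAt_iff_contDiffAt]
        exact (hsm.contDiffAt hnh).fst
      exact ContMDiffAt.comp t (contMDiffAt_extChartAt_symm (hin t ht).2.1) h1
    · have h2 : deriv (fun t ↦ (α t).1) =ᶠ[𝓝 t] fun t ↦ (α t).2 := by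
        filter_upwards [hnh] with s hs using hd s hs
      rw [coordAccel, (hco t ht).deriv.deriv_eq, (hco t ht).deriv.self_of_nhds,
        (hco t ht).self_of_nhds, h2.deriv_eq, h2.self_of_nhds, 
        show deriv (fun t ↦ (α t).2) t = _ from
          ((ContinuousLinearMap.snd ℝ E E).hasFDerivAt.comp_hasDerivAt t (hin t ht).1).deriv]
      simp [geodesicField]

/-- Geodesics have constant speed. -/
theorem IsGeodesic.norm_velocity_eq {γ : ℝ → M} (h : IsGeodesic E γ) (s t : ℝ) :
    ‖velocity E γ s‖ = ‖velocity E γ t‖ := by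
  have hd : ∀ t, HasDerivAt (fun s ↦ (inner ℝ (velocity E γ s) (velocity E γ s) : ℝ)) 0 t := by
    intro t
    have hg := isGeodesic_iff.1 h t
    have hsrc := mem_extChartAt_source (I := 𝓘(ℝ, E)) (γ t)
    have h1 := (isMetricOn_chartMetric (E := E) (γ t)).hasDerivAt_speed
      (y := extChartAt 𝓘(ℝ, E) (γ t) ∘ γ) ((extChartAt 𝓘(ℝ, E) (γ t)).map_source hsrc)
      ((contDiffAt_extChartAt_comp le_rfl hg.contMDiffAt hsrc).of_le (by norm_cast))
      hg.coordAccel_eq_zero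
    refine h1.congr_of_eventuallyEq ?_
    filter_upwards [hg.contMDiffAt.continuousAt.eventually
      (extChartAt_source_mem_nhds (I := 𝓘(ℝ, E)) (γ t))] with s hs
    rw [← coord_velocity ((h.contMDiff s).mdifferentiableAt (by simp)) hs]
    exact (chartMetric_coord hs _ _).symm
  have hconst := is_const_of_deriv_eq_zero (fun t ↦ (hd t).differentiableAt)
    (fun t ↦ (hd t).deriv) s t
  rw [@norm_eq_sqrt_real_inner (TangentSpace 𝓘(ℝ, E) (γ s)),
    @norm_eq_sqrt_real_inner (TangentSpace 𝓘(ℝ, E) (γ t)), hconst]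

end LocalGeodesics

/-! ### The isometry group and geodesic symmetries. -/

section Symmetries

variable {E : Type*} [NormedAddCommGroup E] [NormedSpace ℝ E]
  {M : Type*} [MetricSpace M] [ChartedSpace E M] [IsManifold 𝓘(ℝ, E) ∞ M]
  [RiemannianBundle (fun x : M ↦ TangentSpace 𝓘(ℝ, E) x)]

variable (E M) in
/-- The group of isometries. -/
def isometryGroup : Subgroup (Equiv.Perm M) where
  carrier := {e | IsRiemannianIsometry E e ∧ IsRiemannianIsometry E e.symm}
  one_mem' := ⟨.id, .id⟩
  mul_mem' ha hb := ⟨ha.1.comp hb.1, hb.2.comp ha.2⟩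
  inv_mem' ha := ⟨ha.2, ha.1⟩

variable (E) in
/-- `s` is a geodesic symmetry at `p`. -/
structure IsSymmetryAt (p : M) (s : Equiv.Perm M) : Prop where
  mem : s ∈ isometryGroup E M
  tangentMap_eq : ∀ u : TangentSpace 𝓘(ℝ, E) p,
    tangentMap 𝓘(ℝ, E) 𝓘(ℝ, E) s ⟨p, u⟩ = (⟨p, -u⟩ : TangentBundle 𝓘(ℝ, E) M)

theorem IsSymmetricSpace.exists_isSymmetryAt (h : IsSymmetricSpace E M) (p : M) :
    ∃ s, IsSymmetryAt E p s := by
  obtain ⟨s, hs, hp⟩ := h p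
  have h1 : IsRiemannianIsometry E (s : M → M) := ⟨s.contMDiff, hs⟩
  refine ⟨s.toEquiv, ⟨h1, s.symm.contMDiff, fun x u w ↦ ?_⟩, hp⟩
  obtain ⟨z, rfl⟩ := s.surjective x
  have hsurj : Function.Surjective (mfderiv 𝓘(ℝ, E) 𝓘(ℝ, E) s z) :=
    (s.mfderivToContinuousLinearEquiv (by simp) z).surjective
  obtain ⟨u, rfl⟩ := hsurj u
  obtain ⟨w, rfl⟩ := hsurj w
  have hid : IsRiemannianIsometry E (s.symm ∘ s : M → M) := by
    rw [show (s.symm ∘ s : M → M) = fun x ↦ x from funext s.symm_apply_apply]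
    exact .id
  have h2 := hid.inner_mfderiv z u w
  rw [mfderiv_comp z ((s.symm.contMDiff _).mdifferentiableAt (by simp))
    ((s.contMDiff _).mdifferentiableAt (by simp))] at h2
  exact h2.trans (hs z u w).symm

namespace IsSymmetryAt

variable {p : M} {s : Equiv.Perm M}

theorem isRiemannianIsometry (h : IsSymmetryAt E p s) : IsRiemannianIsometry E s := h.mem.1

/-- The equality `tangentMap_eq` takes place in the tangent bundle, so it includes equality of base
points. -/
theorem apply_self (h : IsSymmetryAt E p s) : s p = p :=
  congrArg TotalSpace.proj (h.tangentMap_eq 0)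

theorem coord_mfderiv (h : IsSymmetryAt E p s) (c : M) (u : TangentSpace 𝓘(ℝ, E) p) :
    coord c (s p) (mfderiv 𝓘(ℝ, E) 𝓘(ℝ, E) s p u) = -coord c p u := by
  have := congrArg (fun X : TangentBundle 𝓘(ℝ, E) M ↦ coord c X.proj X.snd) (h.tangentMap_eq u)
  exact this.trans (map_neg (coord c p) u)

theorem fderiv_chartMap (h : IsSymmetryAt E p s) (u : E) :
    fderiv ℝ (chartMap E p p s) (extChartAt 𝓘(ℝ, E) p p) u = -u := by
  -- A variable point `x` can be substituted by the inverse chart at `y`; the centre `p` of the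
  -- chart cannot.
  have key : ∀ x ∈ (extChartAt 𝓘(ℝ, E) p).source, s x ∈ (extChartAt 𝓘(ℝ, E) p).source →
      ∀ u : TangentSpace 𝓘(ℝ, E) x,
      fderiv ℝ (chartMap E p p s) (extChartAt 𝓘(ℝ, E) p x) (coord p x u) =
        coord p (s x) (mfderiv 𝓘(ℝ, E) 𝓘(ℝ, E) s x u) := by
    intro x hx hx' u
    obtain ⟨y, hy, rfl⟩ : ∃ y ∈ (extChartAt 𝓘(ℝ, E) p).target,
        (extChartAt 𝓘(ℝ, E) p).symm y = x :=
      ⟨_, (extChartAt 𝓘(ℝ, E) p).map_source hx, (extChartAt 𝓘(ℝ, E) p).left_inv hx⟩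
    rw [(extChartAt 𝓘(ℝ, E) p).right_inv hy,
      RiemGeom.fderiv_chartMap h.isRiemannianIsometry.contMDiff hy hx']
    congr 2
    exact mfderiv_symm_coord hy u
  have hp := mem_extChartAt_source (I := 𝓘(ℝ, E)) p
  obtain ⟨u, rfl⟩ := (isInvertible_coord (E := E) hp).surjective u
  rw [key p hp (by rw [h.apply_self]; exact hp), h.coord_mfderiv]

variable [FiniteDimensional ℝ E]
  [IsContMDiffRiemannianBundle 𝓘(ℝ, E) ∞ E (fun x : M ↦ TangentSpace 𝓘(ℝ, E) x)]

/-- A symmetry reverses the geodesics through its centre. -/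
theorem apply_geodesic {γ : ℝ → M} (h : IsSymmetryAt E (γ 0) s) {S : Set ℝ} (hS : IsOpen S)
    (hS' : IsPreconnected S) (hγ : ∀ t ∈ S, IsGeodesicAt E γ t)
    (hneg : ∀ t ∈ S, -t ∈ S) (h0 : (0 : ℝ) ∈ S) : ∀ t ∈ S, s (γ t) = γ (-t) := by
  have h1 : ∀ t ∈ S, IsGeodesicAt E (s ∘ γ) t :=
    fun t ht ↦ (hγ t ht).comp_isometry h.isRiemannianIsometry
  have h2 : ∀ t ∈ S, IsGeodesicAt E (fun t ↦ γ (-t)) t := fun t ht ↦ (hγ _ (hneg t ht)).comp_neg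
  refine eqOn_of_isGeodesicAt hS hS' h1 h2 h0 ?_
  have hsrc := mem_extChartAt_source (I := 𝓘(ℝ, E)) (γ 0)
  have hsrc' : (s ∘ γ) 0 ∈ (extChartAt 𝓘(ℝ, E) (γ 0)).source := by
    rw [Function.comp_apply, h.apply_self]; exact hsrc
  have hγd := (hγ 0 h0).contMDiffAt.mdifferentiableAt (by simp)
  refine eventuallyEq_of_isGeodesicAt (c := γ 0) (Filter.eventually_of_mem (hS.mem_nhds h0) h1)
    (Filter.eventually_of_mem (hS.mem_nhds h0) h2) hsrc' (by simp [h.apply_self]) ?_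
  have hv : deriv (extChartAt 𝓘(ℝ, E) (γ 0) ∘ (s ∘ γ)) 0 =
      -deriv (extChartAt 𝓘(ℝ, E) (γ 0) ∘ γ) 0 := by
    rw [← coord_velocity ((h1 0 h0).contMDiffAt.mdifferentiableAt (by simp)) hsrc',
      ← coord_velocity hγd hsrc, ← h.coord_mfderiv (γ 0) (velocity E γ 0)]
    have := (HasMFDerivAt.comp 0 ((h.isRiemannianIsometry.contMDiff (γ 0)).mdifferentiableAt
      (by simp)).hasMFDerivAt hγd.hasMFDerivAt).mfderiv
    exact congrArg (fun L ↦ coord (γ 0) (s (γ 0)) (L (1 : ℝ))) this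
  refine hv.trans ?_
  have := deriv_comp_neg (extChartAt 𝓘(ℝ, E) (γ 0) ∘ γ) 0
  rw [neg_zero] at this
  exact this.symm

end IsSymmetryAt

end Symmetries

/-! ### Isometries and unit speed geodesics with respect to the distance. -/

section Distance

open Manifold

variable {E : Type*} [NormedAddCommGroup E] [NormedSpace ℝ E]
  {M : Type*} [MetricSpace M] [ChartedSpace E M] [IsManifold 𝓘(ℝ, E) ∞ M]
  [RiemannianBundle (fun x : M ↦ TangentSpace 𝓘(ℝ, E) x)]
  [IsRiemannianManifold 𝓘(ℝ, E) M]

/-- Composition with `s` preserves the length of paths, and the distance is the infimum of lengths.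
Equality needs the same for the inverse of `s`. -/
theorem IsRiemannianIsometry.edist_le {s : M → M} (hs : IsRiemannianIsometry E s) (x y : M) :
    edist (s x) (s y) ≤ edist x y := by
  rw [IsRiemannianManifold.out (I := 𝓘(ℝ, E)) (s x), IsRiemannianManifold.out (I := 𝓘(ℝ, E)) x]
  refine le_of_forall_gt fun r hr ↦ ?_
  obtain ⟨γ, h0, h1, hγ, hlen, -⟩ :=
    exists_lt_locally_constant_of_riemannianEDist_lt hr zero_lt_one
  have hle : riemannianEDist 𝓘(ℝ, E) (s x) (s y) ≤ pathELength 𝓘(ℝ, E) (s ∘ γ) 0 1 :=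
    riemannianEDist_le_pathELength ((hs.contMDiff.of_le (by norm_cast)).comp hγ).contMDiffOn
      (by simp [h0]) (by simp [h1]) zero_le_one
  refine (hle.trans_eq ?_).trans_lt hlen
  rw [pathELength_eq_lintegral_mfderiv_Icc, pathELength_eq_lintegral_mfderiv_Icc]
  refine MeasureTheory.lintegral_congr fun t ↦ ?_
  rw [mfderiv_comp t ((hs.contMDiff _).mdifferentiableAt (by simp))
    ((hγ t).mdifferentiableAt (by simp))]
  have := hs.norm_mfderiv (γ t) (mfderiv 𝓘(ℝ, ℝ) 𝓘(ℝ, E) γ t (1 : ℝ))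
  simp only [enorm, nnnorm]
  congr 1
  exact Subtype.ext this

theorem dist_apply_of_mem_isometryGroup {s : Equiv.Perm M} (hs : s ∈ isometryGroup E M) (x y : M) :
    dist (s x) (s y) = dist x y := by
  have h1 := hs.1.edist_le x y
  have h2 := hs.2.edist_le (s x) (s y)
  rw [s.symm_apply_apply, s.symm_apply_apply] at h2
  rw [dist_edist, dist_edist, le_antisymm h1 h2]

theorem IsUnitSpeedGeodesic.dist_le {γ : ℝ → M} (h : IsUnitSpeedGeodesic E γ) (s t : ℝ) :
    dist (γ s) (γ t) ≤ |s - t| := by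
  wlog hst : s ≤ t generalizing s t
  · rw [dist_comm, abs_sub_comm]; exact this t s (le_of_not_ge hst)
  have h1 : edist (γ s) (γ t) ≤ ENNReal.ofReal (t - s) := by
    rw [IsRiemannianManifold.out (I := 𝓘(ℝ, E)) (γ s)]
    refine (riemannianEDist_le_pathELength (γ := γ)
      (h.contMDiff.of_le (by norm_cast)).contMDiffOn rfl rfl hst).trans_eq ?_
    rw [pathELength_eq_lintegral_mfderiv_Icc]
    have : ∀ r, ‖mfderiv 𝓘(ℝ, ℝ) 𝓘(ℝ, E) γ r (1 : ℝ)‖ₑ = 1 := by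
      intro r
      have := h.norm_velocity r
      rw [← enorm_norm]
      change ‖‖velocity E γ r‖‖ₑ = 1
      rw [this]; simp
    refine (MeasureTheory.lintegral_congr this).trans ?_
    simp
  rw [dist_edist, abs_sub_comm, abs_of_nonneg (sub_nonneg.2 hst)]
  exact ENNReal.toReal_le_of_le_ofReal (sub_nonneg.2 hst) h1

end Distance

/-! ### Extension of geodesics by transvections. -/

section GlobalGeodesics

variable {E : Type*} [NormedAddCommGroup E] [NormedSpace ℝ E] [FiniteDimensional ℝ E]
  {M : Type*} [MetricSpace M] [ChartedSpace E M] [IsManifold 𝓘(ℝ, E) ∞ M]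
  [RiemannianBundle (fun x : M ↦ TangentSpace 𝓘(ℝ, E) x)]
  [IsContMDiffRiemannianBundle 𝓘(ℝ, E) ∞ E (fun x : M ↦ TangentSpace 𝓘(ℝ, E) x)]

/-- In a symmetric space every geodesic germ extends to a geodesic on the real line, and this
geodesic is translated into itself by an isometry. -/
theorem IsSymmetricSpace.exists_isGeodesic (h : IsSymmetricSpace E M) (p : M) (v : E) :
    ∃ γ : ℝ → M, IsGeodesic E γ ∧ γ 0 = p ∧ deriv (extChartAt 𝓘(ℝ, E) p ∘ γ) 0 = v ∧
      ∃ T ∈ isometryGroup E M, ∃ a > 0, ∀ t, T (γ t) = γ (t + a) := by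
  obtain ⟨c, ε, hε, hc0, hcv, hc⟩ := exists_isGeodesicAt p v
  -- The germ lives on `(-4a, 4a)`. Around its second centre `c a` this leaves the symmetric
  -- interval of radius `3a`, enough for a translation by `2a` on `(-4a, 2a)`.
  set a := ε / 4 with ha
  have ha0 : 0 < a := by positivity
  have hεa : ε = 4 * a := by rw [ha]; ring
  obtain ⟨s₀, hs₀⟩ := h.exists_isSymmetryAt (c 0)
  obtain ⟨s₁, hs₁⟩ := h.exists_isSymmetryAt (c a)
  have e₀ : ∀ t ∈ Set.Ioo (-ε) ε, s₀ (c t) = c (-t) :=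
    hs₀.apply_geodesic isOpen_Ioo isPreconnected_Ioo hc
      (fun t ht ↦ ⟨by linarith [ht.2], by linarith [ht.1]⟩) ⟨by linarith, hε⟩
  have e₁ : ∀ t ∈ Set.Ioo (-(3 * a)) (3 * a), s₁ (c (t + a)) = c (-t + a) := by
    refine IsSymmetryAt.apply_geodesic (γ := fun t ↦ c (t + a)) (by simpa using hs₁) isOpen_Ioo
      isPreconnected_Ioo (fun t ht ↦ (hc _ ⟨?_, ?_⟩).comp_add)
      (fun t ht ↦ ⟨by linarith [ht.2], by linarith [ht.1]⟩) ⟨by linarith, by linarith⟩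
    · linarith [ht.1]
    · linarith [ht.2]
  -- The reflections `t ↦ -t` and `t ↦ 2a - t` of the parameter compose to `t ↦ t + 2a`.
  set T : Equiv.Perm M := s₁ * s₀ with hT
  have hTmem : T ∈ isometryGroup E M := mul_mem hs₁.mem hs₀.mem
  have eT : ∀ t ∈ Set.Ioo (-(4 * a)) (2 * a), T (c t) = c (t + 2 * a) := by
    intro t ht
    rw [hT, Equiv.Perm.mul_apply, e₀ t ⟨by linarith [ht.1], by linarith [ht.2]⟩]
    have := e₁ (-t - a) ⟨by linarith [ht.2], by linarith [ht.1]⟩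
    rw [show -t - a + a = -t by ring, show -(-t - a) + a = t + 2 * a by ring] at this
    exact this
  set k : ℝ → ℤ := fun t ↦ ⌊t / (2 * a)⌋ with hk
  -- The piece of `c` on `[0, 2a)` is moved by the powers of `T`.
  set γ : ℝ → M := fun t ↦ (T ^ k t) (c (t - k t * (2 * a))) with hγ
  have hfloor : ∀ t (n : ℤ), n * (2 * a) ≤ t → t < (n + 1) * (2 * a) → k t = n := by
    intro t n h1 h2
    rw [hk]
    simp only
    rw [Int.floor_eq_iff, le_div_iff₀ (by positivity), div_lt_iff₀ (by positivity)]
    exact ⟨h1, h2⟩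
  -- The formula with a fixed `n` stays valid on both sides of the jump of `k` at `2an`. Hence `γ`
  -- is locally an isometric image of a shift of `c`, also at the seams.
  have hloc : ∀ t (n : ℤ), |t - n * (2 * a)| < 2 * a → γ t = (T ^ n) (c (t - n * (2 * a))) := by
    intro t n ht
    rw [abs_lt] at ht
    rcases le_or_gt (n * (2 * a)) t with hle | hlt
    · have : k t = n := hfloor t n hle (by linarith [ht.2])
      simp only [hγ, this]
    · have : k t = n - 1 := hfloor t (n - 1) (by push_cast; linarith [ht.1]) (by push_cast; linarith)
      simp only [hγ, this]
      have h1 := eT (t - n * (2 * a)) ⟨by linarith [ht.1], by linarith⟩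
      have h2 : t - ((n - 1 : ℤ) : ℝ) * (2 * a) = t - n * (2 * a) + 2 * a := by push_cast; ring
      rw [h2, ← h1, ← Equiv.Perm.mul_apply, ← zpow_add_one, sub_add_cancel]
  have hnear : ∀ t, |t - k t * (2 * a)| < 2 * a := by
    intro t
    have h1 := Int.floor_le (t / (2 * a))
    have h2 := Int.lt_floor_add_one (t / (2 * a))
    rw [le_div_iff₀ (by positivity)] at h1
    rw [div_lt_iff₀ (by positivity)] at h2
    rw [abs_lt]
    constructor <;> linarith
  have heq : ∀ (t : ℝ) (n : ℤ), |t - n * (2 * a)| < 2 * a →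
      γ =ᶠ[𝓝 t] (T ^ n) ∘ fun r ↦ c (r + -(n * (2 * a))) := by
    intro t n ht
    have : ∀ᶠ r in 𝓝 t, |r - n * (2 * a)| < 2 * a := by
      have hcont : Continuous fun r : ℝ ↦ |r - n * (2 * a)| := by fun_prop
      exact hcont.continuousAt.eventually (Iio_mem_nhds ht)
    filter_upwards [this] with r hr
    exact hloc r n hr
  have hcγ : γ =ᶠ[𝓝 0] c := by
    have := heq 0 0 (by simpa using ha0)
    simpa using this
  refine ⟨γ, isGeodesic_iff.2 fun t ↦ ?_, ?_, ?_, T, hTmem, 2 * a, by positivity, fun t ↦ ?_⟩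
  · refine IsGeodesicAt.congr ?_ (heq t (k t) (hnear t))
    have hmem : T ^ k t ∈ isometryGroup E M := zpow_mem hTmem _
    refine IsGeodesicAt.comp_isometry (IsGeodesicAt.comp_add (hc _ ?_)) hmem.1
    have := abs_lt.1 (hnear t)
    constructor <;> linarith [this.1, this.2]
  · rw [hcγ.self_of_nhds, hc0]
  · rw [(hcγ.fun_comp _).deriv_eq, ← hcv]
  · have : k (t + 2 * a) = k t + 1 := by
      simp only [hk]
      rw [add_div, div_self (by positivity), Int.floor_add_one]
    simp only [hγ, this]
    rw [← Equiv.Perm.mul_apply, ← zpow_one_add, add_comm 1]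
    congr 2
    push_cast; ring

/-- Unit speed geodesics with given initial velocity. -/
theorem IsSymmetricSpace.exists_isUnitSpeedGeodesic (h : IsSymmetricSpace E M) (p : M)
    (v : TangentSpace 𝓘(ℝ, E) p) (hv : ‖v‖ = 1) :
    ∃ γ : ℝ → M, IsUnitSpeedGeodesic E γ ∧ γ 0 = p ∧
      (∀ c : M, p ∈ (extChartAt 𝓘(ℝ, E) c).source →
        deriv (extChartAt 𝓘(ℝ, E) c ∘ γ) 0 = coord c p v) ∧
      ∃ T ∈ isometryGroup E M, ∃ a > 0, ∀ t, T (γ t) = γ (t + a) := by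
  obtain ⟨γ, hγ, h0, hd, hT⟩ := h.exists_isGeodesic p (coord p p v)
  subst h0
  have hsrc := mem_extChartAt_source (I := 𝓘(ℝ, E)) (γ 0)
  have hγd := (hγ.contMDiff 0).mdifferentiableAt (by simp)
  rw [← coord_velocity hγd hsrc] at hd
  have hvel := (isInvertible_coord (E := E) hsrc).injective hd
  refine ⟨γ, ⟨hγ, fun t ↦ ?_⟩, rfl, fun c hc ↦ ?_, hT⟩
  · rw [hγ.norm_velocity_eq t 0, hvel, hv]
  · rw [← coord_velocity hγd hc, hvel]

end GlobalGeodesics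

/-! ### Busemann functions and minimizing lines. -/

section Busemann

variable {M : Type*} [MetricSpace M] {γ : ℝ → M} {b : M → ℝ}

theorem IsBusemannFunction.sub_le_dist (hb : IsBusemannFunction γ b) (x y : M) :
    b x - b y ≤ dist x y := by
  refine le_of_tendsto ((hb x).sub (hb y)) (Eventually.of_forall fun t ↦ ?_)
  linarith [dist_triangle x y (γ t)]

theorem IsBusemannFunction.abs_sub_le_dist (hb : IsBusemannFunction γ b) (x y : M) :
    |b x - b y| ≤ dist x y :=
  abs_sub_le_iff.2 ⟨hb.sub_le_dist x y, dist_comm y x ▸ hb.sub_le_dist y x⟩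

theorem IsBusemannFunction.unique {b' : M → ℝ} (hb : IsBusemannFunction γ b)
    (hb' : IsBusemannFunction γ b') : b = b' :=
  funext fun x ↦ tendsto_nhds_unique (hb x) (hb' x)

/-- A curve which is translated into itself by an isometry and has a Busemann function
is a minimizing line. -/
theorem IsBusemannFunction.dist_eq (hb : IsBusemannFunction γ b)
    (hlip : ∀ s t, dist (γ s) (γ t) ≤ |s - t|) {a : ℝ} (ha : 0 < a)
    (htrans : ∀ s t, dist (γ (s + a)) (γ (t + a)) = dist (γ s) (γ t)) (s t : ℝ) :
    dist (γ s) (γ t) = |s - t| := by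
  wlog hst : s ≤ t generalizing s t
  · rw [dist_comm, abs_sub_comm]; exact this t s (le_of_not_ge hst)
  refine le_antisymm (hlip s t) (le_of_not_gt fun hlt ↦ ?_)
  rw [abs_sub_comm, abs_of_nonneg (sub_nonneg.2 hst)] at hlt
  have htrans' : ∀ (n : ℕ) (s t : ℝ), dist (γ (s + n * a)) (γ (t + n * a)) = dist (γ s) (γ t) := by
    intro n
    induction n with
    | zero => simp
    | succ n ih =>
      intro s t
      have := htrans (s + n * a) (t + n * a)
      rw [ih] at this
      rw [← this]
      push_cast
      ring_nf
  -- The interval `[-Na, Na]` contains `s` and `t`, and its length `L` is a positive multiple of the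
  -- period `a`.
  obtain ⟨N, hN⟩ := exists_nat_ge ((|s| + |t| + 1) / a)
  rw [div_le_iff₀ ha] at hN
  set x : ℝ := -(N * a) with hx
  set L : ℝ := ((2 * N : ℕ) : ℝ) * a with hL
  have hLx : x + L = N * a := by rw [hx, hL]; push_cast; ring
  have hL0 : 0 < L := by
    rw [hL]; push_cast
    nlinarith [abs_nonneg s, abs_nonneg t]
  have hxs : x ≤ s := by linarith [neg_abs_le s, abs_nonneg t]
  have hty : t ≤ x + L := by linarith [le_abs_self t, abs_nonneg s]
  -- The defect over one period of length `L`; it is positive because the shortcut from `γ s` to `γ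
  -- t` lies in that period.
  set η : ℝ := L - dist (γ x) (γ (x + L)) with hη
  have hη0 : 0 < η := by
    have h1 := hlip x s
    have h2 := hlip t (x + L)
    rw [abs_sub_comm, abs_of_nonneg (by linarith)] at h1 h2
    have h3 := dist_triangle (γ x) (γ s) (γ (x + L))
    have h4 := dist_triangle (γ s) (γ t) (γ (x + L))
    linarith
  have hstep : ∀ m : ℕ, dist (γ x) (γ (x + m * L)) ≤ m * (L - η) := by
    intro m
    induction m with
    | zero => simp
    | succ m ih =>
      have h1 := dist_triangle (γ x) (γ (x + m * L)) (γ (x + (m + 1 : ℕ) * L))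
      have h2 := htrans' (m * (2 * N)) x (x + L)
      have e1 : x + ((m * (2 * N) : ℕ) : ℝ) * a = x + m * L := by rw [hL]; push_cast; ring
      have e2 : x + L + ((m * (2 * N) : ℕ) : ℝ) * a = x + (m + 1 : ℕ) * L := by
        rw [hL]; push_cast; ring
      rw [e1, e2] at h2
      have h3 : dist (γ x) (γ (x + L)) = L - η := by rw [hη]; ring
      push_cast at *
      linarith
  have htop : Tendsto (fun m : ℕ ↦ x + m * L) atTop atTop :=
    tendsto_atTop_add_const_left _ _ (tendsto_natCast_atTop_atTop.atTop_mul_const hL0)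
  have h1 := (hb (γ x)).comp htop
  have h2 : Tendsto (fun m : ℕ ↦ -x - m * η) atTop atBot :=
    tendsto_atBot_add_const_left _ _
      (tendsto_neg_atTop_atBot.comp (tendsto_natCast_atTop_atTop.atTop_mul_const hη0))
  -- Each period contributes the defect `η` again, so the quantity whose limit is `b (γ x)` is
  -- unbounded below.
  have h3 : Tendsto (fun m : ℕ ↦ dist (γ x) (γ (x + m * L)) - (x + m * L)) atTop atBot := by
    refine tendsto_atBot_mono (fun m ↦ ?_) h2
    linarith [hstep m]
  exact not_tendsto_nhds_of_tendsto_atBot h3 _ h1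

theorem IsBusemannFunction.apply_line (hb : IsBusemannFunction γ b)
    (hline : ∀ s t, dist (γ s) (γ t) = |s - t|) (t : ℝ) : b (γ t) = -t := by
  refine tendsto_nhds_unique (hb (γ t)) (tendsto_const_nhds.congr' ?_)
  filter_upwards [eventually_ge_atTop t] with r hr
  rw [hline, abs_sub_comm, abs_of_nonneg (by linarith)]
  ring

end Busemann

/-! ### Variation of functions along paths of bounded length. -/

section Paths

open Manifold

variable {E : Type*} [NormedAddCommGroup E] [NormedSpace ℝ E]
  {M : Type*} [MetricSpace M] [ChartedSpace E M] [IsManifold 𝓘(ℝ, E) ∞ M]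
  [RiemannianBundle (fun x : M ↦ TangentSpace 𝓘(ℝ, E) x)]
  [IsRiemannianManifold 𝓘(ℝ, E) M]

variable (E) in
theorem exists_path_of_dist_lt {x y : M} {r : ℝ} (h : dist x y < r) :
    ∃ γ : ℝ → M, γ 0 = x ∧ γ 1 = y ∧ ContMDiff 𝓘(ℝ, ℝ) 𝓘(ℝ, E) 1 γ ∧
      pathELength 𝓘(ℝ, E) γ 0 1 < ENNReal.ofReal r := by
  have h1 : riemannianEDist 𝓘(ℝ, E) x y < ENNReal.ofReal r := by
    rw [← IsRiemannianManifold.out (I := 𝓘(ℝ, E)) x y, edist_lt_ofReal]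
    exact h
  obtain ⟨γ, h0, h1, hγ, hlen, -⟩ :=
    exists_lt_locally_constant_of_riemannianEDist_lt h1 zero_lt_one
  exact ⟨γ, h0, h1, hγ, hlen⟩

theorem edist_le_pathELength {γ : ℝ → M} (hγ : ContMDiff 𝓘(ℝ, ℝ) 𝓘(ℝ, E) 1 γ) {s t : ℝ}
    (hst : s ≤ t) : edist (γ s) (γ t) ≤ pathELength 𝓘(ℝ, E) γ s t := by
  rw [IsRiemannianManifold.out (I := 𝓘(ℝ, E)) (γ s)]
  exact riemannianEDist_le_pathELength hγ.contMDiffOn rfl rfl hst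

/-- The differential of a real function. -/
noncomputable def differential (b : M → ℝ) (x : M) : TangentSpace 𝓘(ℝ, E) x →L[ℝ] ℝ :=
  mfderiv 𝓘(ℝ, E) 𝓘(ℝ, ℝ) b x

/-- A function whose differential is bounded by `k` along a path of length less than `l` varies by
at most `k l` along the path. -/
theorem abs_sub_le_of_path {b : M → ℝ} (hb : ContMDiff 𝓘(ℝ, E) 𝓘(ℝ, ℝ) 1 b) {γ : ℝ → M}
    (hγ : ContMDiff 𝓘(ℝ, ℝ) 𝓘(ℝ, E) 1 γ) {k l : ℝ} (hk : 0 ≤ k) (hl : 0 ≤ l)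
    (hlen : pathELength 𝓘(ℝ, E) γ 0 1 ≤ ENNReal.ofReal l)
    (hbound : ∀ t ∈ Set.Icc (0 : ℝ) 1, ∀ u : TangentSpace 𝓘(ℝ, E) (γ t),
      |differential b (γ t) u| ≤ k * ‖u‖) :
    |b (γ 0) - b (γ 1)| ≤ k * l := by
  -- `ℝ` is itself a Riemannian manifold, so the variation of `b` is bounded by the length of the
  -- path `b ∘ γ`.
  have h1 : edist (b (γ 0)) (b (γ 1)) ≤ pathELength 𝓘(ℝ, ℝ) (b ∘ γ) 0 1 := by
    rw [IsRiemannianManifold.out (I := 𝓘(ℝ, ℝ)) (b (γ 0))]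
    exact riemannianEDist_le_pathELength (hb.comp hγ).contMDiffOn rfl rfl zero_le_one
  have h2 : pathELength 𝓘(ℝ, ℝ) (b ∘ γ) 0 1 ≤ ENNReal.ofReal k * pathELength 𝓘(ℝ, E) γ 0 1 := by
    rw [pathELength_eq_lintegral_mfderiv_Icc, pathELength_eq_lintegral_mfderiv_Icc,
      ← MeasureTheory.lintegral_const_mul' _ _ ENNReal.ofReal_ne_top]
    refine MeasureTheory.setLIntegral_mono' measurableSet_Icc fun t ht ↦ ?_
    rw [mfderiv_comp t ((hb _).mdifferentiableAt (by simp)) ((hγ t).mdifferentiableAt (by simp))]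
    have h3 := hbound t ht (mfderiv 𝓘(ℝ, ℝ) 𝓘(ℝ, E) γ t (1 : ℝ))
    rw [enorm_tangentSpace_vectorSpace]
    refine (Real.enorm_eq_ofReal_abs _).trans_le ((ENNReal.ofReal_le_ofReal h3).trans_eq ?_)
    rw [ENNReal.ofReal_mul hk, ofReal_norm]
    rfl
  have h3 := h1.trans (h2.trans (mul_le_mul_right hlen _))
  rw [← ENNReal.ofReal_mul hk, edist_dist, ENNReal.ofReal_le_ofReal_iff (by positivity)] at h3
  exact h3

end Paths

/-! ### Intermediate points and directions of steepest descent. -/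

section LengthSpace

open Manifold

/-- Approximate intermediate points. -/
theorem exists_dist_eq_dist_le (E : Type*) [NormedAddCommGroup E] [NormedSpace ℝ E]
    {M : Type*} [MetricSpace M] [ChartedSpace E M] [IsManifold 𝓘(ℝ, E) ∞ M]
    [RiemannianBundle (fun x : M ↦ TangentSpace 𝓘(ℝ, E) x)]
    [IsRiemannianManifold 𝓘(ℝ, E) M]
    {x y : M} {r δ : ℝ} (hr : 0 ≤ r) (hrd : r ≤ dist x y)
    (hδ : 0 < δ) : ∃ z, dist x z = r ∧ dist z y ≤ dist x y - r + δ := by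
  obtain ⟨γ, h0, h1, hγ, hlen⟩ := exists_path_of_dist_lt E (show dist x y < dist x y + δ by linarith)
  have hcont : ContinuousOn (fun t ↦ dist x (γ t)) (Set.Icc 0 1) :=
    (continuous_const.dist hγ.continuous).continuousOn
  obtain ⟨t, ht, htr⟩ := intermediate_value_Icc zero_le_one hcont
    (show r ∈ Set.Icc (dist x (γ 0)) (dist x (γ 1)) by rw [h0, h1, dist_self]; exact ⟨hr, hrd⟩)
  refine ⟨γ t, htr, ?_⟩
  have e1 := edist_le_pathELength hγ ht.1
  have e2 := edist_le_pathELength hγ ht.2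
  have e3 := (add_le_add e1 e2).trans_lt ((pathELength_add ht.1 ht.2).trans_lt hlen)
  rw [h0, h1, edist_dist, edist_dist, ← ENNReal.ofReal_add dist_nonneg dist_nonneg,
    ENNReal.ofReal_lt_ofReal_iff (by positivity)] at e3
  simp only at htr
  linarith

/-- Busemann functions decrease with slope one in a suitable direction. -/
theorem IsBusemannFunction.exists_le_sub (E : Type*) [NormedAddCommGroup E] [NormedSpace ℝ E]
    {M : Type*} [MetricSpace M] [ChartedSpace E M] [IsManifold 𝓘(ℝ, E) ∞ M]
    [RiemannianBundle (fun x : M ↦ TangentSpace 𝓘(ℝ, E) x)]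
    [IsRiemannianManifold 𝓘(ℝ, E) M]
    {γ : ℝ → M} {b : M → ℝ} (hb : IsBusemannFunction γ b)
    {x : M} {r : ℝ} (hr : 0 ≤ r) (hcomp : IsCompact (Metric.closedBall x r)) :
    ∃ z, dist x z = r ∧ b z ≤ b x - r := by
  have hfar : ∀ᶠ n : ℕ in atTop, r ≤ dist x (γ n) := by
    have h1 : Tendsto (fun n : ℕ ↦ (dist x (γ n) - n) + n) atTop atTop :=
      ((hb x).comp tendsto_natCast_atTop_atTop).add_atTop tendsto_natCast_atTop_atTop
    filter_upwards [h1.eventually_ge_atTop r] with n hn using by simpa using hn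
  obtain ⟨N, hN⟩ := eventually_atTop.1 hfar
  -- Points of the sphere of radius `r` that lie almost on minimizing paths from `x` to `γ (N + n)`.
  -- A limit point of them, by compactness, is the required `z`.
  have hz : ∀ n : ℕ, ∃ z, dist x z = r ∧
      dist z (γ (N + n : ℕ)) ≤ dist x (γ (N + n : ℕ)) - r + 1 / (n + 1 : ℝ) := fun n ↦
    exists_dist_eq_dist_le E hr (hN _ (by omega)) (by positivity)
  choose z hz1 hz2 using hz
  obtain ⟨w, -, φ, hφ, hlim⟩ := hcomp.tendsto_subseq (x := z) fun n ↦ by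
    rw [Metric.mem_closedBall, dist_comm, hz1]
  refine ⟨w, ?_, ?_⟩
  · have h1 : Tendsto (fun n ↦ dist x (z (φ n))) atTop (𝓝 (dist x w)) :=
      tendsto_const_nhds.dist hlim
    simp only [hz1] at h1
    exact tendsto_nhds_unique h1 tendsto_const_nhds |>.symm ▸ rfl
  · have hto : Tendsto (fun n : ℕ ↦ ((N + φ n : ℕ) : ℝ)) atTop atTop :=
      tendsto_natCast_atTop_atTop.comp 
        (tendsto_atTop_mono (fun n ↦ Nat.le_add_left _ _) hφ.tendsto_atTop)
    have h1 := (hb w).comp hto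
    have h2 := (hb x).comp hto
    have h3 : Tendsto (fun n : ℕ ↦ 1 / ((φ n : ℝ) + 1)) atTop (𝓝 0) :=
      tendsto_one_div_add_atTop_nhds_zero_nat.comp hφ.tendsto_atTop
    have h4 : Tendsto (fun n ↦ dist w (z (φ n))) atTop (𝓝 0) := by
      simpa using (tendsto_const_nhds (x := w)).dist hlim
    have h5 := ((h2.sub_const r).add h3).add h4
    simp only [add_zero] at h5
    refine le_of_tendsto_of_tendsto h1 h5 (Eventually.of_forall fun n ↦ ?_)
    have h6 := hz2 (φ n)
    have h7 := dist_triangle w (z (φ n)) (γ (N + φ n : ℕ))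
    simp only [Function.comp_apply]
    linarith

end LengthSpace

/-! ### Functions on the manifold read in charts. -/

section ChartFunctions

variable {E : Type*} [NormedAddCommGroup E] [NormedSpace ℝ E]

theorem coordHessian_congr {G : E → E →L[ℝ] E →L[ℝ] ℝ} {f f' : E → ℝ} {y : E}
    (h : f =ᶠ[𝓝 y] f') : coordHessian G f y = coordHessian G f' y := by
  rw [coordHessian, coordHessian, h.fderiv.fderiv_eq, h.fderiv_eq]

variable {M : Type*} [MetricSpace M] [ChartedSpace E M] [IsManifold 𝓘(ℝ, E) ∞ M]

theorem contDiffAt_comp_symm {b : M → ℝ} (hb : ContMDiff 𝓘(ℝ, E) 𝓘(ℝ, ℝ) 2 b) {c : M} {y : E}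
    (hy : y ∈ (extChartAt 𝓘(ℝ, E) c).target) :
    ContDiffAt ℝ 2 (b ∘ (extChartAt 𝓘(ℝ, E) c).symm) y := by
  rw [← contMDiffAt_iff_contDiffAt]
  exact (hb _).comp y ((contMDiffAt_extChartAt_symm hy).of_le (by norm_cast))

theorem fderiv_comp_symm_coord {b : M → ℝ} (hb : ContMDiff 𝓘(ℝ, E) 𝓘(ℝ, ℝ) 2 b) {c x : M}
    (hx : x ∈ (extChartAt 𝓘(ℝ, E) c).source) (u : TangentSpace 𝓘(ℝ, E) x) :
    fderiv ℝ (b ∘ (extChartAt 𝓘(ℝ, E) c).symm) (extChartAt 𝓘(ℝ, E) c x) (coord c x u) =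
      differential b x u := by
  obtain ⟨y, hy, rfl⟩ : ∃ y ∈ (extChartAt 𝓘(ℝ, E) c).target,
      (extChartAt 𝓘(ℝ, E) c).symm y = x :=
    ⟨_, (extChartAt 𝓘(ℝ, E) c).map_source hx, (extChartAt 𝓘(ℝ, E) c).left_inv hx⟩
  rw [(extChartAt 𝓘(ℝ, E) c).right_inv hy, ← mfderiv_eq_fderiv]
  have h := (((hb ((extChartAt 𝓘(ℝ, E) c).symm y)).mdifferentiableAt (by simp)).hasMFDerivAt.comp y
    (mdifferentiableAt_extChartAt_symm hy).hasMFDerivAt).mfderiv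
  have h2 := congrArg (fun L ↦ L (coord (E := E) c ((extChartAt 𝓘(ℝ, E) c).symm y) u)) h
  exact h2.trans (congrArg (differential b ((extChartAt 𝓘(ℝ, E) c).symm y))
    (mfderiv_symm_coord hy u))

theorem hasDerivAt_comp_curve {b : M → ℝ} (hb : ContMDiff 𝓘(ℝ, E) 𝓘(ℝ, ℝ) 2 b) {c : M} {γ : ℝ → M}
    {t : ℝ} (hγ : ContMDiffAt 𝓘(ℝ, ℝ) 𝓘(ℝ, E) 1 γ t) (hc : γ t ∈ (extChartAt 𝓘(ℝ, E) c).source) :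
    HasDerivAt (b ∘ γ) (fderiv ℝ (b ∘ (extChartAt 𝓘(ℝ, E) c).symm) (extChartAt 𝓘(ℝ, E) c (γ t))
      (deriv (extChartAt 𝓘(ℝ, E) c ∘ γ) t)) t := by
  have h1 : HasDerivAt (extChartAt 𝓘(ℝ, E) c ∘ γ) (deriv (extChartAt 𝓘(ℝ, E) c ∘ γ) t) t :=
    ((contDiffAt_extChartAt_comp (by norm_cast) hγ hc).differentiableAt (by simp)).hasDerivAt
  have h2 : HasFDerivAt (b ∘ (extChartAt 𝓘(ℝ, E) c).symm) _ ((extChartAt 𝓘(ℝ, E) c ∘ γ) t) :=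
    ((contDiffAt_comp_symm hb ((extChartAt 𝓘(ℝ, E) c).map_source hc)).differentiableAt
      (by simp)).hasFDerivAt
  refine (h2.comp_hasDerivAt t h1).congr_of_eventuallyEq ?_
  filter_upwards [hγ.continuousAt.eventually (extChartAt_source_mem_nhds' hc)] with s hs
  simp only [Function.comp_apply]
  rw [(extChartAt 𝓘(ℝ, E) c).left_inv hs]

end ChartFunctions

/-! ### Hessians at the centre of a symmetry. -/

section Hessian

variable {E : Type*} [NormedAddCommGroup E] [NormedSpace ℝ E] [FiniteDimensional ℝ E]
  {M : Type*} [MetricSpace M] [ChartedSpace E M] [IsManifold 𝓘(ℝ, E) ∞ M]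
  [RiemannianBundle (fun x : M ↦ TangentSpace 𝓘(ℝ, E) x)]
  [IsContMDiffRiemannianBundle 𝓘(ℝ, E) ∞ E (fun x : M ↦ TangentSpace 𝓘(ℝ, E) x)]

/-- The Laplacian at `γ t` is defined in the chart centred there, while the curvature argument
follows `γ` in one fixed chart. The identity, read as an isometry between the two charts, transports
the Hessian. -/
theorem coordHessian_eq_zero_of_chart {b : M → ℝ} (hb : ContMDiff 𝓘(ℝ, E) 𝓘(ℝ, ℝ) 2 b) {p c : M}
    (h : coordHessian (chartMetric p) (b ∘ (extChartAt 𝓘(ℝ, E) p).symm)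
      (extChartAt 𝓘(ℝ, E) p p) = 0) (hc : p ∈ (extChartAt 𝓘(ℝ, E) c).source) :
    coordHessian (chartMetric c) (b ∘ (extChartAt 𝓘(ℝ, E) c).symm)
      (extChartAt 𝓘(ℝ, E) c p) = 0 := by
  have hp := mem_extChartAt_source (I := 𝓘(ℝ, E)) p
  have hy : extChartAt 𝓘(ℝ, E) c p ∈ (extChartAt 𝓘(ℝ, E) c).target :=
    (extChartAt 𝓘(ℝ, E) c).map_source hc
  have hinv : (extChartAt 𝓘(ℝ, E) c).symm (extChartAt 𝓘(ℝ, E) c p) = p :=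
    (extChartAt 𝓘(ℝ, E) c).left_inv hc
  have hFy : chartMap E c p (fun x ↦ x) (extChartAt 𝓘(ℝ, E) c p) = extChartAt 𝓘(ℝ, E) p p := by
    simp only [chartMap, Function.comp_apply, hinv]
  have heq : b ∘ (extChartAt 𝓘(ℝ, E) c).symm =ᶠ[𝓝 (extChartAt 𝓘(ℝ, E) c p)]
      (b ∘ (extChartAt 𝓘(ℝ, E) p).symm) ∘ chartMap E c p (fun x ↦ x) := by
    have h1 : ∀ᶠ y in 𝓝 (extChartAt 𝓘(ℝ, E) c p),
        (extChartAt 𝓘(ℝ, E) c).symm y ∈ (extChartAt 𝓘(ℝ, E) p).source :=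
      (continuousAt_extChartAt_symm'' hy).eventually
        (by rw [hinv]; exact extChartAt_source_mem_nhds p)
    filter_upwards [h1] with y hy1
    simp only [chartMap, Function.comp_apply]
    rw [(extChartAt 𝓘(ℝ, E) p).left_inv hy1]
  rw [coordHessian_congr heq]
  ext u w
  rw [IsRiemannianIsometry.id.coordHessian_chartMap hy (by rw [hinv]; exact hp)
    (by rw [hFy]; exact contDiffAt_comp_symm hb ((extChartAt 𝓘(ℝ, E) p).map_source hp)), hFy, h]
  rfl

/-- The symmetry at `p` preserves Hessians at `p`. -/
theorem IsSymmetryAt.coordHessian_comp {p : M} {s : Equiv.Perm M} (hs : IsSymmetryAt E p s)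
    {b : M → ℝ} (hb : ContMDiff 𝓘(ℝ, E) 𝓘(ℝ, ℝ) 2 b) :
    coordHessian (chartMetric p) ((b ∘ s) ∘ (extChartAt 𝓘(ℝ, E) p).symm)
      (extChartAt 𝓘(ℝ, E) p p) =
    coordHessian (chartMetric p) (b ∘ (extChartAt 𝓘(ℝ, E) p).symm) (extChartAt 𝓘(ℝ, E) p p) := by
  have hp := mem_extChartAt_source (I := 𝓘(ℝ, E)) p
  have hy : extChartAt 𝓘(ℝ, E) p p ∈ (extChartAt 𝓘(ℝ, E) p).target :=
    (extChartAt 𝓘(ℝ, E) p).map_source hp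
  have hinv : s ((extChartAt 𝓘(ℝ, E) p).symm (extChartAt 𝓘(ℝ, E) p p)) = p := by
    rw [(extChartAt 𝓘(ℝ, E) p).left_inv hp, hs.apply_self]
  have hFy : chartMap E p p s (extChartAt 𝓘(ℝ, E) p p) = extChartAt 𝓘(ℝ, E) p p := by
    simp only [chartMap, Function.comp_apply, hinv]
  have heq : (b ∘ s) ∘ (extChartAt 𝓘(ℝ, E) p).symm =ᶠ[𝓝 (extChartAt 𝓘(ℝ, E) p p)]
      (b ∘ (extChartAt 𝓘(ℝ, E) p).symm) ∘ chartMap E p p s := by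
    have h0 : ContinuousAt (s ∘ (extChartAt 𝓘(ℝ, E) p).symm) (extChartAt 𝓘(ℝ, E) p p) :=
      hs.isRiemannianIsometry.contMDiff.continuous.continuousAt.comp
        (continuousAt_extChartAt_symm'' hy)
    have h1 : ∀ᶠ y in 𝓝 (extChartAt 𝓘(ℝ, E) p p),
        s ((extChartAt 𝓘(ℝ, E) p).symm y) ∈ (extChartAt 𝓘(ℝ, E) p).source :=
      h0.eventually (by
        rw [Function.comp_apply, hinv]; exact extChartAt_source_mem_nhds p)
    filter_upwards [h1] with y hy1
    simp only [chartMap, Function.comp_apply]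
    rw [(extChartAt 𝓘(ℝ, E) p).left_inv hy1]
  rw [coordHessian_congr heq]
  ext u w
  -- The differential of `s` at `p` is `-id`, and the two signs cancel by bilinearity.
  rw [hs.isRiemannianIsometry.coordHessian_chartMap hy (by rw [hinv]; exact hp)
    (by rw [hFy]; exact contDiffAt_comp_symm hb hy), hFy, hs.fderiv_chartMap, hs.fderiv_chartMap]
  simp

/-- If `Δb = 0` at `p` and `b + b'` has a minimum at `p`, where `b'` is the reflection of `b`
at `p`, then the Hessian of `b` vanishes at `p`. -/
theorem IsSymmetryAt.coordHessian_eq_zero {p : M} {s : Equiv.Perm M} (hs : IsSymmetryAt E p s)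
    {b b' : M → ℝ} (hb : ContMDiff 𝓘(ℝ, E) 𝓘(ℝ, ℝ) 2 b) (hb' : ContMDiff 𝓘(ℝ, E) 𝓘(ℝ, ℝ) 2 b')
    (hbb : b' ∘ s = b) (hmin : ∀ x, b p + b' p ≤ b x + b' x) (hlap : laplacian E b p = 0) :
    coordHessian (chartMetric p) (b ∘ (extChartAt 𝓘(ℝ, E) p).symm)
      (extChartAt 𝓘(ℝ, E) p p) = 0 := by
  have hp := mem_extChartAt_source (I := 𝓘(ℝ, E)) p
  have hy : extChartAt 𝓘(ℝ, E) p p ∈ (extChartAt 𝓘(ℝ, E) p).target :=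
    (extChartAt 𝓘(ℝ, E) p).map_source hp
  have hmet := isMetricOn_chartMetric (E := E) p
  set y := extChartAt 𝓘(ℝ, E) p p with hyp
  set f := b ∘ (extChartAt 𝓘(ℝ, E) p).symm with hf
  set f' := b' ∘ (extChartAt 𝓘(ℝ, E) p).symm with hf'
  have hfd : ContDiffAt ℝ 2 f y := contDiffAt_comp_symm hb hy
  have hfd' : ContDiffAt ℝ 2 f' y := contDiffAt_comp_symm hb' hy
  have hH : coordHessian (chartMetric p) f' y = coordHessian (chartMetric p) f y := by
    have := hs.coordHessian_comp hb'
    rw [hbb] at this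
    exact this.symm
  have hlm : IsLocalMin (f + f') y := by
    refine Eventually.of_forall fun z ↦ ?_
    simp only [hf, hf', Pi.add_apply, Function.comp_apply]
    rw [hyp, (extChartAt 𝓘(ℝ, E) p).left_inv hp]
    exact hmin _
  -- At the critical point `y` of `f + f'` the Christoffel terms drop out.
  have hsum : ∀ u, coordHessian (chartMetric p) f y u u + coordHessian (chartMetric p) f' y u u =
      fderiv ℝ (fderiv ℝ (f + f')) y u u := by
    intro u
    have h1 : fderiv ℝ (f + f') =ᶠ[𝓝 y] fun x ↦ fderiv ℝ f x + fderiv ℝ f' x := by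
      filter_upwards [hfd.eventually (by simp), hfd'.eventually (by simp)] with x hx hx'
      exact fderiv_add (hx.differentiableAt (by simp)) (hx'.differentiableAt (by simp))
    have h2 := hlm.fderiv_eq_zero
    rw [h1.self_of_nhds] at h2
    have h3 := congrArg (fun L : E →L[ℝ] ℝ ↦ L (christoffel (chartMetric p) y u u)) h2
    simp only [add_apply, zero_apply] at h3
    rw [h1.fderiv_eq, fderiv_fun_add
      ((hfd.fderiv_right (m := 1) (by norm_num)).differentiableAt (by simp))
      ((hfd'.fderiv_right (m := 1) (by norm_num)).differentiableAt (by simp))]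
    simp only [coordHessian, sub_apply, ContinuousLinearMap.comp_apply,
      ContinuousLinearMap.compL_apply, add_apply]
    linarith
  refine hmet.eq_zero_of_trace_eq_zero hy (hmet.coordHessian_symm hy hfd) (fun u ↦ ?_) hlap
  have h1 := fderiv_fderiv_nonneg_of_isLocalMin hlm (hfd.add hfd') u
  rw [← hsum, hH] at h1
  linarith

end Hessian

/-! ### Busemann functions in symmetric spaces with minimal horospheres; flatness. -/

section AsymptoticallyHarmonic

open Manifold

variable {E : Type*} [NormedAddCommGroup E] [NormedSpace ℝ E] [FiniteDimensional ℝ E]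
  {M : Type*} [MetricSpace M] [ChartedSpace E M] [IsManifold 𝓘(ℝ, E) ∞ M]
  [RiemannianBundle (fun x : M ↦ TangentSpace 𝓘(ℝ, E) x)]
  [IsContMDiffRiemannianBundle 𝓘(ℝ, E) ∞ E (fun x : M ↦ TangentSpace 𝓘(ℝ, E) x)]
  [IsRiemannianManifold 𝓘(ℝ, E) M]

theorem IsUnitSpeedGeodesic.comp_isometry {γ : ℝ → M} (hγ : IsUnitSpeedGeodesic E γ) {s : M → M}
    (hs : IsRiemannianIsometry E s) : IsUnitSpeedGeodesic E (s ∘ γ) where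
  toIsGeodesic := isGeodesic_iff.2 fun t ↦ (isGeodesic_iff.1 hγ.toIsGeodesic t).comp_isometry hs
  norm_velocity t := by
    rw [velocity, mfderiv_comp t ((hs.contMDiff _).mdifferentiableAt (by simp))
      ((hγ.contMDiff t).mdifferentiableAt (by simp))]
    exact (hs.norm_mfderiv (γ t) (velocity E γ t)).trans (hγ.norm_velocity t)

/-- In a symmetric space whose horospheres are minimal, the Hessian of the Busemann function of a
line vanishes along the line. -/
theorem coordHessian_busemann_eq_zero (hsym : IsSymmetricSpace E M)
    (hM : IsAsymptoticallyHarmonic E M 0) {γ : ℝ → M} (hγ : IsUnitSpeedGeodesic E γ)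
    (hline : ∀ s t, dist (γ s) (γ t) = |s - t|) {b : M → ℝ} (hb : IsBusemannFunction γ b)
    (hb2 : ContMDiff 𝓘(ℝ, E) 𝓘(ℝ, ℝ) 2 b) (hlap : ∀ x, laplacian E b x = 0) (t : ℝ) :
    coordHessian (chartMetric (γ t)) (b ∘ (extChartAt 𝓘(ℝ, E) (γ t)).symm)
      (extChartAt 𝓘(ℝ, E) (γ t) (γ t)) = 0 := by
  obtain ⟨s, hs⟩ := hsym.exists_isSymmetryAt (γ t)
  obtain ⟨b', hb', hb2', -⟩ :=
    hM.laplacian_busemann (s ∘ γ) (hγ.comp_isometry hs.isRiemannianIsometry)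
  have hrev : ∀ r, s (γ r) = γ (2 * t - r) := by
    intro r
    have := IsSymmetryAt.apply_geodesic (γ := fun r ↦ γ (r + t)) (s := s) (by simpa using hs)
      isOpen_univ isPreconnected_univ
      (fun r _ ↦ (isGeodesic_iff.1 hγ.toIsGeodesic _).comp_add) (fun _ _ ↦ trivial) trivial
      (r - t) trivial
    rw [sub_add_cancel] at this
    rw [this]
    congr 1; ring
  have hbb : b' ∘ s = b := by
    refine IsBusemannFunction.unique (γ := γ) (fun x ↦ ?_) hb
    have := hb' (s x)
    simp only [Function.comp_apply, dist_apply_of_mem_isometryGroup hs.mem] at this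
    exact this
  refine hs.coordHessian_eq_zero hb2 hb2' hbb (fun x ↦ ?_) (hlap _)
  have h1 : b (γ t) = -t := hb.apply_line hline t
  have h2 : b' (γ t) = -t := by
    rw [← h1, ← hbb, Function.comp_apply, hs.apply_self]
  rw [h1, h2]
  -- `d(x, γ r) + d(x, γ (2t - r)) ≥ 2(r - t)` because `γ` is a line; subtracting `2r` leaves `-2t`
  -- in the limit.
  refine ge_of_tendsto ((hb x).add (hb' x)) ?_
  filter_upwards [eventually_ge_atTop t] with r hr
  rw [Function.comp_apply, hrev]
  have h3 := dist_triangle_left (γ r) (γ (2 * t - r)) x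
  rw [hline, abs_of_nonneg (by linarith)] at h3
  linarith

/-- The gradient of a Busemann function of class `C²` has length at most one. -/
theorem IsBusemannFunction.gradient_le_one (hsym : IsSymmetricSpace E M) {γ : ℝ → M} {b : M → ℝ}
    (hb : IsBusemannFunction γ b) (hb2 : ContMDiff 𝓘(ℝ, E) 𝓘(ℝ, ℝ) 2 b) {c x : M}
    (hx : x ∈ (extChartAt 𝓘(ℝ, E) c).source) {g : TangentSpace 𝓘(ℝ, E) x}
    (hg : coord c x g = coordGradient (chartMetric c) (b ∘ (extChartAt 𝓘(ℝ, E) c).symm)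
      (extChartAt 𝓘(ℝ, E) c x)) : ‖g‖ ≤ 1 := by
  have hmet := isMetricOn_chartMetric (E := E) c
  have hy := (extChartAt 𝓘(ℝ, E) c).map_source hx
  rcases eq_or_ne g 0 with rfl | hg0
  · simp
  have hgn : ‖g‖ ≠ 0 := norm_ne_zero_iff.2 hg0
  -- Along the unit speed geodesic in the direction of the gradient, `b` has derivative `‖g‖` at `0`
  -- and is `1`-Lipschitz.
  obtain ⟨σ, hσ, h0, hd, -⟩ := hsym.exists_isUnitSpeedGeodesic x (‖g‖⁻¹ • g)
    (by rw [norm_smul, norm_inv, norm_norm, inv_mul_cancel₀ hgn])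
  subst h0
  have h1 := hasDerivAt_comp_curve hb2 (c := c) ((hσ.contMDiff 0).of_le (by norm_cast)) hx
  rw [hd c hx, map_smul, hg, map_smul, ← hmet.apply_coordGradient hy, ← hg,
    chartMetric_coord hx, real_inner_self_eq_norm_sq] at h1
  have h2 := h1.le_of_lip' (C := 1) zero_le_one (Eventually.of_forall fun t ↦ by
    rw [Function.comp_apply, Function.comp_apply, one_mul, Real.norm_eq_abs, Real.norm_eq_abs]
    exact (hb.abs_sub_le_dist _ _).trans (hσ.dist_le _ _))
  have h3 : ‖g‖⁻¹ • ‖g‖ ^ 2 = ‖g‖ := by rw [smul_eq_mul]; field_simp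
  rw [h3, norm_norm] at h2
  exact h2

/-- Busemann functions of class `C²` satisfy the eikonal equation. -/
theorem IsBusemannFunction.eikonal (hsym : IsSymmetricSpace E M) {γ : ℝ → M} {b : M → ℝ}
    (hb : IsBusemannFunction γ b) (hb2 : ContMDiff 𝓘(ℝ, E) 𝓘(ℝ, ℝ) 2 b) {c x : M}
    (hx : x ∈ (extChartAt 𝓘(ℝ, E) c).source) :
    chartMetric c (extChartAt 𝓘(ℝ, E) c x)
      (coordGradient (chartMetric c) (b ∘ (extChartAt 𝓘(ℝ, E) c).symm) (extChartAt 𝓘(ℝ, E) c x))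
      (coordGradient (chartMetric c) (b ∘ (extChartAt 𝓘(ℝ, E) c).symm) (extChartAt 𝓘(ℝ, E) c x))
      = 1 := by
  have hmet := isMetricOn_chartMetric (E := E) c
  set f := b ∘ (extChartAt 𝓘(ℝ, E) c).symm
  have hrepr : ∀ z ∈ (extChartAt 𝓘(ℝ, E) c).source, ∃ g : TangentSpace 𝓘(ℝ, E) z,
      coord c z g = coordGradient (chartMetric c) f (extChartAt 𝓘(ℝ, E) c z) :=
    fun z hz ↦ (isInvertible_coord (E := E) hz).surjective _
  set N : M → ℝ := fun z ↦ chartMetric c (extChartAt 𝓘(ℝ, E) c z)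
    (coordGradient (chartMetric c) f (extChartAt 𝓘(ℝ, E) c z))
    (coordGradient (chartMetric c) f (extChartAt 𝓘(ℝ, E) c z)) with hN
  have hNg : ∀ z (hz : z ∈ (extChartAt 𝓘(ℝ, E) c).source) (g : TangentSpace 𝓘(ℝ, E) z),
      coord c z g = coordGradient (chartMetric c) f (extChartAt 𝓘(ℝ, E) c z) → N z = ‖g‖ ^ 2 := by
    intro z hz g hg
    simp only [hN]
    rw [← hg, chartMetric_coord hz, real_inner_self_eq_norm_sq]
  have hNc : ContinuousAt N x := by
    have hy := (extChartAt 𝓘(ℝ, E) c).map_source hx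
    have h1 := (hmet.contDiffAt_coordGradient hy (contDiffAt_comp_symm hb2 hy)).continuousAt
    have h2 := (hmet.contDiffAt hy).continuousAt
    have h3 : ContinuousAt (fun y ↦ chartMetric c y (coordGradient (chartMetric c) f y)
      (coordGradient (chartMetric c) f y)) (extChartAt 𝓘(ℝ, E) c x) :=
      (h2.clm_apply h1).clm_apply h1
    exact ContinuousAt.comp (f := extChartAt 𝓘(ℝ, E) c) h3 (continuousAt_extChartAt' hx)
  change N x = 1
  obtain ⟨g, hg⟩ := hrepr x hx
  have hle : N x ≤ 1 := by
    rw [hNg x hx g hg]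
    exact pow_le_one₀ (norm_nonneg _) (hb.gradient_le_one hsym hb2 hx hg)
  refine le_antisymm hle (le_of_not_gt fun hlt ↦ ?_)
  -- If the gradient were shorter than `1` at `x`, it would be shorter than `k = √m < 1` nearby. The
  -- bound `1 / 4` gives `k > 1 / 2`, hence `r / k < 2r ≤ ρ`: paths from `x` shorter than `r / k`
  -- stay in the ball where the bound holds.
  obtain ⟨m, hm1, hm2⟩ := exists_between (max_lt hlt (show (1 / 4 : ℝ) < 1 by norm_num))
  have hm4 : (1 / 4 : ℝ) < m := (le_max_right _ _).trans_lt hm1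
  have hm0 : 0 < m := by linarith
  set k := √m with hk
  have hk2 : k ^ 2 = m := Real.sq_sqrt hm0.le
  have hk0 : 0 < k := Real.sqrt_pos.2 hm0
  have hkhalf : 1 / 2 < k := by
    rw [hk, Real.lt_sqrt (by norm_num)]; linarith
  have hloc : LocallyCompactSpace M := Manifold.locallyCompact_of_finiteDimensional 𝓘(ℝ, E)
  have hnear : ∀ᶠ z in 𝓝 x, N z < m ∧ z ∈ (extChartAt 𝓘(ℝ, E) c).source :=
    (hNc.eventually (Iio_mem_nhds ((le_max_left _ _).trans_lt hm1))).and
      (extChartAt_source_mem_nhds' hx)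
  obtain ⟨ρ, hρ, hball⟩ := Metric.eventually_nhds_iff.1 hnear
  obtain ⟨r₀, hr₀, hcpt⟩ := Metric.exists_isCompact_closedBall x
  set r := min r₀ (ρ / 2)
  have hr0 : 0 < r := lt_min hr₀ (by positivity)
  have hrρ : 2 * r ≤ ρ := by linarith [min_le_right r₀ (ρ / 2)]
  obtain ⟨z, hz, hbz⟩ := hb.exists_le_sub E hr0.le
    (hcpt.of_isClosed_subset Metric.isClosed_closedBall
      (Metric.closedBall_subset_closedBall (min_le_left _ _)))
  have hk1 : k < 1 := by
    rw [hk, Real.sqrt_lt' one_pos]; linarith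
  -- choose a path from `x` to `z` which is shorter than `l < r / k`
  obtain ⟨l, hl1, hl2⟩ := exists_between (show r < r / k by
    rw [lt_div_iff₀ hk0]; nlinarith)
  have hl2r : l < 2 * r := by
    refine hl2.trans ?_
    rw [div_lt_iff₀ hk0]; nlinarith
  obtain ⟨σ, h0, h1, hσ, hlen⟩ := exists_path_of_dist_lt E (hz.trans_lt hl1)
  have hin : ∀ t ∈ Set.Icc (0 : ℝ) 1, dist (σ t) x < ρ := by
    intro t ht
    have e1 := ((edist_le_pathELength hσ ht.1).trans (pathELength_mono le_rfl ht.2)).trans_lt hlen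
    rw [h0, edist_lt_ofReal] at e1
    rw [dist_comm]
    linarith
  -- Along the path `b` varies by at most `k * l < r`, but it must drop by at least `r` on the way
  -- to `z`.
  have hbd := abs_sub_le_of_path (hb2.of_le (by norm_num)) hσ hk0.le (by linarith) hlen.le
    (fun t ht u ↦ ?_)
  · rw [h0, h1] at hbd
    have h3 := (le_abs_self _).trans hbd
    have h4 : k * l < r := by rwa [lt_div_iff₀ hk0, mul_comm] at hl2
    linarith
  · obtain ⟨hNt, hst⟩ := hball (hin t ht)
    obtain ⟨g', hg'⟩ := hrepr _ hst
    rw [hNg _ hst g' hg', ← hk2] at hNt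
    have hgk : ‖g'‖ ≤ k := (lt_of_pow_lt_pow_left₀ 2 hk0.le hNt).le
    rw [← fderiv_comp_symm_coord hb2 hst,
      ← hmet.apply_coordGradient ((extChartAt 𝓘(ℝ, E) c).map_source hst), ← hg',
      chartMetric_coord hst]
    exact (abs_real_inner_le_norm _ _).trans (by gcongr)

/-- The geodesic with velocity `v` is a line and an integral curve of `-grad b`, along which the
Hessian of `b` vanishes; the eikonal criterion then applies at `p`. -/
theorem coordCurvature_eq_zero_of_norm_eq_one (hsym : IsSymmetricSpace E M)
    (hM : IsAsymptoticallyHarmonic E M 0) (p : M) (v : TangentSpace 𝓘(ℝ, E) p) (hv : ‖v‖ = 1)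
    (w : E) : coordCurvature (chartMetric p) (extChartAt 𝓘(ℝ, E) p p) w
      (coord p p v) (coord p p v) = 0 := by
  obtain ⟨γ, hγ, h0, hd, T, hT, a, ha, htrans⟩ := hsym.exists_isUnitSpeedGeodesic p v hv
  obtain ⟨b, hb, hb2, hlap⟩ := hM.laplacian_busemann γ hγ
  have hline := hb.dist_eq hγ.dist_le ha fun s t ↦ by
    rw [← htrans, ← htrans, dist_apply_of_mem_isometryGroup hT]
  have hp := mem_extChartAt_source (I := 𝓘(ℝ, E)) p
  have hmet := isMetricOn_chartMetric (E := E) p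
  set y := extChartAt 𝓘(ℝ, E) p ∘ γ with hy
  set f := b ∘ (extChartAt 𝓘(ℝ, E) p).symm
  have hy0 : y 0 = extChartAt 𝓘(ℝ, E) p p := by simp only [hy, Function.comp_apply, h0]
  have hy0t : y 0 ∈ (extChartAt 𝓘(ℝ, E) p).target := hy0 ▸ (extChartAt 𝓘(ℝ, E) p).map_source hp
  have hsrc : ∀ᶠ t in 𝓝 0, γ t ∈ (extChartAt 𝓘(ℝ, E) p).source :=
    hγ.contMDiff.continuous.continuousAt.eventually
      (by rw [h0]; exact extChartAt_source_mem_nhds p)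
  have hderiv : ∀ᶠ t in 𝓝 0,
      HasDerivAt y (-coordGradient (chartMetric p) f (y t)) t := by
    filter_upwards [hsrc] with t ht
    have hγ1 : ContMDiffAt 𝓘(ℝ, ℝ) 𝓘(ℝ, E) 1 γ t := (hγ.contMDiff t).of_le (by norm_cast)
    have hyt : y t ∈ (extChartAt 𝓘(ℝ, E) p).target := (extChartAt 𝓘(ℝ, E) p).map_source ht
    have e1 : chartMetric p (y t) (deriv y t) (deriv y t) = 1 := by
      rw [hy, ← coord_velocity (hγ1.mdifferentiableAt (by simp)) ht]
      refine (chartMetric_coord ht _ _).trans ?_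
      rw [real_inner_self_eq_norm_sq, hγ.norm_velocity, one_pow]
    have e2 : chartMetric p (y t) (coordGradient (chartMetric p) f (y t)) (deriv y t) = -1 := by
      rw [hmet.apply_coordGradient hyt]
      have h3 := hasDerivAt_comp_curve hb2 hγ1 ht
      have h4 : b ∘ γ = fun t ↦ -t := funext fun t ↦ hb.apply_line hline t
      rw [h4] at h3
      exact h3.unique (hasDerivAt_neg t)
    have e3 : chartMetric p (y t) (coordGradient (chartMetric p) f (y t))
        (coordGradient (chartMetric p) f (y t)) = 1 := hb.eikonal hsym hb2 ht
    -- The equality case of Cauchy–Schwarz: the squared length of `y' + grad f` is `1 - 2 + 1 = 0`.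
    have e4 : deriv y t = -coordGradient (chartMetric p) f (y t) := by
      by_contra hne
      have h5 := hmet.pos (y t) hyt (deriv y t + coordGradient (chartMetric p) f (y t))
        (fun h ↦ hne (eq_neg_of_add_eq_zero_left h))
      simp only [map_add, add_apply] at h5
      rw [hmet.symm _ hyt (deriv y t) (coordGradient (chartMetric p) f (y t)), e1, e2, e3] at h5
      linarith
    rw [← e4]
    exact ((contDiffAt_extChartAt_comp (by norm_cast) hγ1 ht).differentiableAt
      (by simp)).hasDerivAt
  have hnear : ∀ᶠ x in 𝓝 (y 0), x ∈ (extChartAt 𝓘(ℝ, E) p).target := hmet.eventually_mem hy0t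
  have key := hmet.coordCurvature_eq_zero_of_eikonal (f := f) hy0t
    (hnear.mono fun x hx ↦ contDiffAt_comp_symm hb2 hx)
    (hnear.mono fun x hx ↦ by
      have := hb.eikonal hsym hb2 ((extChartAt 𝓘(ℝ, E) p).map_target hx)
      rwa [(extChartAt 𝓘(ℝ, E) p).right_inv hx] at this)
    hderiv
    (hsrc.mono fun t ht ↦ coordHessian_eq_zero_of_chart hb2
      (coordHessian_busemann_eq_zero hsym hM hγ hline hb hb2 hlap t) ht) w
  have hgrad : coord p p v = -coordGradient (chartMetric p) f (y 0) := by
    rw [← hd p hp]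
    exact hderiv.self_of_nhds.deriv
  have h6 := coordCurvature_smul (chartMetric p) (y 0) w
    (coordGradient (chartMetric p) f (y 0)) (-1)
  rw [neg_one_smul, key, smul_zero, ← hgrad, hy0] at h6
  exact h6

theorem isFlat_of_isSymmetricSpace (hsym : IsSymmetricSpace E M)
    (hM : IsAsymptoticallyHarmonic E M 0) : IsFlat E M := by
  intro p u v w
  have hp := mem_extChartAt_source (I := 𝓘(ℝ, E)) p
  rw [curvature, (isMetricOn_chartMetric (E := E) p).coordCurvature_eq_zero_of_diagonal
    ((extChartAt 𝓘(ℝ, E) p).map_source hp), map_zero]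
  intro w v
  obtain ⟨v, rfl⟩ := (isInvertible_coord (E := E) hp).surjective v
  rcases eq_or_ne v 0 with rfl | hv
  · simp [coordCurvature]
  have hvn : ‖v‖ ≠ 0 := norm_ne_zero_iff.2 hv
  have h1 := coordCurvature_eq_zero_of_norm_eq_one hsym hM p (‖v‖⁻¹ • v)
    (by rw [norm_smul, norm_inv, norm_norm, inv_mul_cancel₀ hvn]) w
  rw [map_smul, coordCurvature_smul] at h1
  exact (smul_eq_zero.1 h1).resolve_left (by positivity)

end AsymptoticallyHarmonic

end RiemGeom

theorem theorem5 {E : Type*} [NormedAddCommGroup E] [NormedSpace ℝ E] [FiniteDimensional ℝ E]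
    {M : Type*} [MetricSpace M] [ChartedSpace E M] [IsManifold 𝓘(ℝ, E) ∞ M]
    [RiemannianBundle (fun x : M ↦ TangentSpace 𝓘(ℝ, E) x)]
    [IsContMDiffRiemannianBundle 𝓘(ℝ, E) ∞ E (fun x : M ↦ TangentSpace 𝓘(ℝ, E) x)]
    [IsRiemannianManifold 𝓘(ℝ, E) M]
    (hM : RiemGeom.IsAsymptoticallyHarmonic E M 0)
    (hsym : RiemGeom.IsSymmetricSpace E M) :
    RiemGeom.IsFlat E M := by
  exact RiemGeom.isFlat_of_isSymmetricSpace hsym hM
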